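/- Consider the class of equations \[ u_t=a^2(t)u_{xx}+b(t)u-c(t)u^3 , \qquad (*) \] where $a,b,c$ are smooth real functions on an open interval and $a$ and $c$ vanish nowhere. Point transformations are diffeomorphisms $\Phi$ between open subsets of the space of $(t,x,u)$, with connected domain. Such a $\Phi$ maps an equation $E$ of the class to an equation $\tilde E$ of the class if its domain and its image lie over the time intervals of $E$ and $\tilde E$ and its second prolongation, wherever it is defined, maps the submanifold of the second-order jet space given by $E$ to the one given by $\tilde E$. The equivalence groupoid of the class is the set of all such triples $(E,\tilde E,\Phi)$. The (usual) equivalence group $G^\sim$ is the pseudogroup of point transformations of the space of $(t,x,u,a,b,c)$, defined for all values of the arbitrary elements $a,b,c$ with $a\neq0$, $c\neq0$, whose $(t,x,u)$-components depend on $(t,x,u)$ only and form a point transformation that maps every equation of the class defined on its domain to the equation of the class with the transformed arbitrary elements. \textbf{Theorem.} The equivalence group $G^\sim$ of the class $(*)$ is formed by the transformations \[ \tilde t=\theta(t),\quad \tilde x=\delta_1x+\delta_2,\quad \tilde u=\varphi(t)u, \] \[ \tilde a^2(\tilde t)=\frac{\delta_1^2}{\theta_t}a^2(t),\quad \tilde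 b(\tilde t)=\frac{1}{\varphi\theta_t}\bigl(\varphi b(t)+\varphi_t\bigr),\quad \tilde c(\tilde t)=\frac{1}{\varphi^2\theta_t}c(t), \] where $\delta_1\neq0$ and $\delta_2$ are arbitrary constants and $\theta$ and $\varphi$ are arbitrary smooth functions of $t$, on the projection of the domain to the $t$-axis, with $\theta_t\varphi\neq0$; here $\theta_t>0$, as the formula for $\tilde a^2$ requires, and all such parameters occur. These transformations generate the equivalence groupoid of the class, that is, the class is normalized: a point transformation maps an equation $E$ of the class to an equation $\tilde E$ of the class if and only if it is the $(t,x,u)$-part of an element of $G^\sim$ that transforms the arbitrary elements of $E$ into those of $\tilde E$. Equivalently, it has the form above for some $\delta_1,\delta_2,\theta,\varphi$ as above, and the coefficients of $E$ and $\tilde E$ are related by the formulas above for all $t$ in the projection of its domain. -/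

import Mathlib

open Set
open scoped ContDiff

noncomputable section

namespace NWS

/-- An equation `u_t = a(t)^2 u_xx + b(t) u - c(t) u^3` of the class: the coefficients are smooth
real functions on an open interval (only their values there matter), and `a`, `c` do not vanish. -/
structure Equation where
  timeDomain : Set ℝ
  isOpen_timeDomain : IsOpen timeDomain
  isConnected_timeDomain : IsConnected timeDomain
  a : ℝ → ℝ
  b : ℝ → ℝ
  c : ℝ → ℝ
  smooth_a : ContDiffOn ℝ ∞ a timeDomain
  smooth_b : ContDiffOn ℝ ∞ b timeDomain
  smooth_c : ContDiffOn ℝ ∞ c timeDomain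
  a_ne_zero : ∀ t ∈ timeDomain, a t ≠ 0
  c_ne_zero : ∀ t ∈ timeDomain, c t ≠ 0

/-- A (local) nondegenerate point transformation of the space `V`: a smooth injective map on an
open set with everywhere invertible differential, i.e. a diffeomorphism between open sets. -/
structure PointTransformation (V : Type*) [NormedAddCommGroup V] [NormedSpace ℝ V] where
  source : Set V
  toFun : V → V
  isOpen_source : IsOpen source
  smooth : ContDiffOn ℝ ∞ toFun source
  injOn : InjOn toFun source
  nondegenerate : ∀ p ∈ source, Function.Bijective (fderiv ℝ toFun p)

/-- The space of the variables `(t, x, u)`. -/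
abbrev Base : Type := ℝ × ℝ × ℝ

/-- The first-order jet space, with coordinates `(t, x, u, u_t, u_x)`. -/
abbrev Jet1 : Type := ℝ × ℝ × ℝ × ℝ × ℝ

/-- The second-order jet space, for one function `u` of `(t, x)`. -/
@[ext]
structure Jet2 where
  t : ℝ
  x : ℝ
  u : ℝ
  ut : ℝ
  ux : ℝ
  utt : ℝ
  utx : ℝ
  uxx : ℝ

/-- The projection of a first-order jet to `(t, x, u)`. -/
def Jet1.base (j : Jet1) : Base := (j.1, j.2.1, j.2.2.1)

/-- The projection of a second-order jet to the first-order jet space. -/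
def Jet2.toJet1 (j : Jet2) : Jet1 := (j.t, j.x, j.u, j.ut, j.ux)

/-- The total derivative `D_t F = F_t + u_t F_u` of a function `F` of `(t, x, u)`. -/
def totalDt0 (F : Base → ℝ) (j : Jet1) : ℝ := fderiv ℝ F j.base (1, 0, j.2.2.2.1)

/-- The total derivative `D_x F = F_x + u_x F_u` of a function `F` of `(t, x, u)`. -/
def totalDx0 (F : Base → ℝ) (j : Jet1) : ℝ := fderiv ℝ F j.base (0, 1, j.2.2.2.2)

/-- The total derivative `D_t G = G_t + u_t G_u + u_tt G_{u_t} + u_tx G_{u_x}` of a function `G`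
of `(t, x, u, u_t, u_x)`. -/
def totalDt1 (G : Jet1 → ℝ) (j : Jet2) : ℝ :=
  fderiv ℝ G j.toJet1 (1, 0, j.ut, j.utt, j.utx)

/-- The total derivative `D_x G = G_x + u_x G_u + u_tx G_{u_t} + u_xx G_{u_x}` of a function `G`
of `(t, x, u, u_t, u_x)`. -/
def totalDx1 (G : Jet1 → ℝ) (j : Jet2) : ℝ :=
  fderiv ℝ G j.toJet1 (0, 1, j.ux, j.utx, j.uxx)

namespace PointTransformation

variable (Φ : PointTransformation Base)

/-- The component `t̃ = T(t, x, u)`. -/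
def T (p : Base) : ℝ := (Φ.toFun p).1

/-- The component `x̃ = X(t, x, u)`. -/
def X (p : Base) : ℝ := (Φ.toFun p).2.1

/-- The component `ũ = U(t, x, u)`. -/
def U (p : Base) : ℝ := (Φ.toFun p).2.2

/-- The total Jacobian `D_t T D_x X - D_x T D_t X`. The transformation can be prolonged to a jet
over a point of its domain exactly if this does not vanish there. -/
def totalJacobian (j : Jet1) : ℝ :=
  totalDt0 Φ.T j * totalDx0 Φ.X j - totalDx0 Φ.T j * totalDt0 Φ.X j

/-- The transformed derivative `ũ_t̃`, a function of `(t, x, u, u_t, u_x)`. -/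
def newUt (j : Jet1) : ℝ :=
  (totalDx0 Φ.X j * totalDt0 Φ.U j - totalDt0 Φ.X j * totalDx0 Φ.U j) / Φ.totalJacobian j

/-- The transformed derivative `ũ_x̃`, a function of `(t, x, u, u_t, u_x)`. -/
def newUx (j : Jet1) : ℝ :=
  (totalDt0 Φ.T j * totalDx0 Φ.U j - totalDx0 Φ.T j * totalDt0 Φ.U j) / Φ.totalJacobian j

/-- The derivative with respect to the new variable `t̃` of a function of `(t, x, u, u_t, u_x)`. -/
def newDt (G : Jet1 → ℝ) (j : Jet2) : ℝ :=
  (totalDx0 Φ.X j.toJet1 * totalDt1 G j - totalDt0 Φ.X j.toJet1 * totalDx1 G j) /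
    Φ.totalJacobian j.toJet1

/-- The derivative with respect to the new variable `x̃` of a function of `(t, x, u, u_t, u_x)`. -/
def newDx (G : Jet1 → ℝ) (j : Jet2) : ℝ :=
  (totalDt0 Φ.T j.toJet1 * totalDx1 G j - totalDx0 Φ.T j.toJet1 * totalDt1 G j) /
    Φ.totalJacobian j.toJet1

/-- The second prolongation of a point transformation, in the standard form by total
derivatives. -/
def prolong (j : Jet2) : Jet2 where
  t := Φ.T j.toJet1.base
  x := Φ.X j.toJet1.base
  u := Φ.U j.toJet1.base
  ut := Φ.newUt j.toJet1
  ux := Φ.newUx j.toJet1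
  utt := Φ.newDt Φ.newUt j
  utx := Φ.newDx Φ.newUt j
  uxx := Φ.newDx Φ.newUx j

end PointTransformation

/-- The manifold that an equation defines in the second-order jet space. -/
def Equation.manifold (E : Equation) : Set Jet2 :=
  {j | j.t ∈ E.timeDomain ∧
    j.ut = E.a j.t ^ 2 * j.uxx + E.b j.t * j.u - E.c j.t * j.u ^ 3}

/-- The domain of `Φ` lies over the time interval of `E`, its image over that of `E'`. -/
def Fits (Φ : PointTransformation Base) (E E' : Equation) : Prop :=
  ∀ p ∈ Φ.source, p.1 ∈ E.timeDomain ∧ Φ.T p ∈ E'.timeDomain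

/-- `Φ` maps `E` to `E'`: wherever its second prolongation is defined, it maps the manifold of `E`
into that of `E'` and the complement of the former into the complement of the latter. -/
def MapsEquation (Φ : PointTransformation Base) (E E' : Equation) : Prop :=
  Fits Φ E E' ∧ ∀ j : Jet2, j.toJet1.base ∈ Φ.source → Φ.totalJacobian j.toJet1 ≠ 0 →
    (j ∈ E.manifold ↔ Φ.prolong j ∈ E'.manifold)

/-- The equivalence groupoid of the class: the triples of an initial equation, a target equation
and a point transformation, with connected domain, that maps the former to the latter. -/
def equivalenceGroupoid : Set (Equation × Equation × PointTransformation Base) :=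
  {g | IsConnected g.2.2.source ∧ MapsEquation g.2.2 g.1 g.2.1}

/-- The admissible values `(α, β, γ)` of the arbitrary elements `(a, b, c)`. -/
def elementValues : Set (ℝ × ℝ × ℝ) := {q | q.1 ≠ 0 ∧ q.2.2 ≠ 0}

/-- A point transformation of the extended space of `(t, x, u)` and the values `(α, β, γ)` of the
arbitrary elements, projectable to the space of `(t, x, u)`. -/
structure ExtendedTransformation where
  base : PointTransformation Base
  total : PointTransformation (Base × (ℝ × ℝ × ℝ))
  source_total : total.source = base.source ×ˢ elementValues
  projectable : ∀ z ∈ total.source, (total.toFun z).1 = base.toFun z.1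

/-- `Ψ` transforms the arbitrary elements of `E` into those of `E'`, on the domain of `Ψ`. -/
def ExtendedTransformation.TransformsElements (Ψ : ExtendedTransformation)
    (E E' : Equation) : Prop :=
  Fits Ψ.base E E' ∧ ∀ p ∈ Ψ.base.source,
    (Ψ.total.toFun (p, (E.a p.1, E.b p.1, E.c p.1))).2 =
      (E'.a (Ψ.base.T p), E'.b (Ψ.base.T p), E'.c (Ψ.base.T p))

/-- The (usual) equivalence group of the class, as a pseudogroup of local transformations of the
extended space: the transformations that map every equation of the class whose coefficients are
defined on the domain to an equation of the class, namely to the one whose arbitrary elements are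
the transformed ones. -/
def equivalenceGroup : Set ExtendedTransformation :=
  {Ψ | IsConnected Ψ.base.source ∧
    ∀ E : Equation, (∀ p ∈ Ψ.base.source, p.1 ∈ E.timeDomain) →
      ∃ E' : Equation, Ψ.TransformsElements E E' ∧ MapsEquation Ψ.base E E'}

/-- The standing conditions on the parameters, over a set `J` of times: `δ₁ ≠ 0`, and `θ`, `φ` are
smooth on `J` with `θ_t φ ≠ 0`. -/
structure IsParameters (J : Set ℝ) (θ φ : ℝ → ℝ) (δ₁ : ℝ) : Prop where
  delta_ne_zero : δ₁ ≠ 0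
  smooth_theta : ContDiffOn ℝ ∞ θ J
  smooth_phi : ContDiffOn ℝ ∞ φ J
  ne_zero : ∀ t ∈ J, deriv θ t * φ t ≠ 0

/-- `t̃ = θ(t)`, `x̃ = δ₁ x + δ₂`, `ũ = φ(t) u`. -/
def HasForm (Φ : PointTransformation Base) (θ φ : ℝ → ℝ) (δ₁ δ₂ : ℝ) : Prop :=
  ∀ t x u : ℝ, (t, x, u) ∈ Φ.source → Φ.toFun (t, x, u) = (θ t, δ₁ * x + δ₂, φ t * u)

/-- The relations between the values `(α, β, γ)` and `(α', β', γ')` of the initial and the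
transformed arbitrary elements at the time `t`. -/
def ElementFormulas (θ φ : ℝ → ℝ) (δ₁ t : ℝ) (q q' : ℝ × ℝ × ℝ) : Prop :=
  q'.1 ^ 2 = δ₁ ^ 2 / deriv θ t * q.1 ^ 2 ∧
  q'.2.1 = 1 / (φ t * deriv θ t) * (φ t * q.2.1 + deriv φ t) ∧
  q'.2.2 = 1 / (φ t ^ 2 * deriv θ t) * q.2.2

/-- The extended transformation `Ψ` is given by the formulas with parameters `θ, φ, δ₁, δ₂`. -/
def ExtendedTransformation.IsGivenBy (Ψ : ExtendedTransformation) (θ φ : ℝ → ℝ)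
    (δ₁ δ₂ : ℝ) : Prop :=
  HasForm Ψ.base θ φ δ₁ δ₂ ∧
    ∀ p ∈ Ψ.base.source, ∀ q ∈ elementValues,
      ElementFormulas θ φ δ₁ p.1 q (Ψ.total.toFun (p, q)).2

end NWS

end

/-!
The second prolongation of a transformation `Φ = (T, X, U)` that maps `E` to `E'` may be evaluated
on the manifold of `E`, where `u_tt` is free. As `ũ_x̃x̃` depends on `u_tt` unless `D_x T = 0`, this
forces `T_x = T_u = 0`. Splitting the remaining equation with respect to `u_xx` gives
`a² (D_x X)² = a'(T)² T_t`, whence `X_u = 0` and `X_xx = 0`, and splitting it with respect to `u_x`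
gives `U_uu = 0`. Comparing the cubic terms in `u` yields `U = u U_u` and `c = T_t c'(T) U_u²`. So
`U_u²`, and with it `U_u`, does not depend on `x`; the coefficient of `u_x` then shows `X_t = 0`.

On a connected domain this makes `X` an affine function of `x`. Moreover `T` is a function of `t`:
by `δ₁² a² dt = a'² dT` it is determined by `t` through strictly monotone primitives. So is `U_u`,
because its square is and it does not vanish. Conversely, for a transformation of this form the
prolonged equation is compared with the initial one coefficient by coefficient.

Applied to the equations with constant coefficients, this gives the form of the elements of the
equivalence group. The formulas determine `ã` only up to sign, so that a transformation of the given
form is extended to the arbitrary elements by choosing a smooth root of `δ₁² / θ_t`.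
-/

namespace NWS

open Filter Topology

noncomputable section

/-! ### Directional derivatives -/

section DirectionalDerivative

theorem eventually_eq_add_smul_of_hasDerivAt {W : Type*} [NormedAddCommGroup W] [NormedSpace ℝ W]
    {g : ℝ → W} {c : W} {a : ℝ} (h : ∀ᶠ s in 𝓝 a, HasDerivAt g c s) :
    ∀ᶠ s in 𝓝 a, g s = g a + (s - a) • c := by
  obtain ⟨ε, hε, hg⟩ := Metric.eventually_nhds_iff_ball.1 h
  have hl : ∀ s, HasDerivAt (fun s => (s - a) • c) c s := fun s => by
    simpa using ((hasDerivAt_id s).sub_const a).smul_const c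
  obtain ⟨k, hk⟩ := Metric.isOpen_ball.exists_eq_add_of_deriv_eq (f := g)
    (convex_ball a ε).isPreconnected
    (fun s hs => (hg s hs).differentiableAt.differentiableWithinAt)
    (fun s _ => (hl s).differentiableAt.differentiableWithinAt)
    (fun s hs => (hg s hs).deriv.trans (hl s).deriv.symm)
  filter_upwards [Metric.ball_mem_nhds a hε] with s hs
  rw [hk hs, hk (Metric.mem_ball_self hε)]
  simp [add_comm]

variable {V W : Type*} [NormedAddCommGroup V] [NormedSpace ℝ V] [NormedAddCommGroup W]
  [NormedSpace ℝ W] {S : Set V} {F : V → W} {p v : V}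

/-- The derivative of `F` in the direction `v`, as a function of the point; the partial
derivatives are those in the directions of the coordinate axes. -/
def dirDeriv (v : V) (F : V → W) (p : V) : W := fderiv ℝ F p v

theorem differentiableAt_of_contDiffOn (hS : IsOpen S) (hF : ContDiffOn ℝ ∞ F S) (hp : p ∈ S) :
    DifferentiableAt ℝ F p :=
  (hF.contDiffAt (hS.mem_nhds hp)).differentiableAt (by simp)

theorem contDiffOn_dirDeriv (hS : IsOpen S) (hF : ContDiffOn ℝ ∞ F S) (v : V) :
    ContDiffOn ℝ ∞ (dirDeriv v F) S :=
  (hF.fderiv_of_isOpen hS (m := ∞) le_rfl).clm_apply contDiffOn_const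

theorem dirDeriv_comm (hS : IsOpen S) (hF : ContDiffOn ℝ ∞ F S) (hp : p ∈ S) (v w : V) :
    dirDeriv v (dirDeriv w F) p = dirDeriv w (dirDeriv v F) p := by
  have hd : DifferentiableAt ℝ (fderiv ℝ F) p :=
    differentiableAt_of_contDiffOn hS (hF.fderiv_of_isOpen hS (m := ∞) le_rfl) hp
  have hsecond (a b : V) : dirDeriv a (dirDeriv b F) p = fderiv ℝ (fderiv ℝ F) p a b := by
    have hb : HasFDerivAt (dirDeriv b F) _ p := hd.hasFDerivAt.clm_apply (hasFDerivAt_const b p)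
    simp [dirDeriv, hb.fderiv]
  have hsymm : IsSymmSndFDerivAt ℝ F p :=
    (hF.contDiffAt (hS.mem_nhds hp)).isSymmSndFDerivAt
      (by simpa using WithTop.coe_le_coe.2 (le_top : (2 : ℕ∞) ≤ ⊤))
  rw [hsecond, hsecond, hsymm v w]

theorem dirDeriv_eq_zero_of_const_on {k : W} (hS : IsOpen S) (hF : ∀ q ∈ S, F q = k)
    (hp : p ∈ S) : dirDeriv v F p = 0 := by
  have h : F =ᶠ[𝓝 p] fun _ => k := eventuallyEq_of_mem (hS.mem_nhds hp) hF
  simp [dirDeriv, h.fderiv_eq]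

theorem dirDeriv_dirDeriv_eq_zero (hS : IsOpen S) (hF : ContDiffOn ℝ ∞ F S)
    (h : ∀ q ∈ S, dirDeriv v F q = 0) (hp : p ∈ S) (w : V) :
    dirDeriv v (dirDeriv w F) p = 0 := by
  rw [dirDeriv_comm hS hF hp, dirDeriv_eq_zero_of_const_on hS h hp]

theorem dirDeriv_dirDeriv_dirDeriv_eq_zero (hS : IsOpen S) (hF : ContDiffOn ℝ ∞ F S)
    (h : ∀ q ∈ S, dirDeriv v (dirDeriv v F) q = 0) (hp : p ∈ S) (w : V) :
    dirDeriv v (dirDeriv v (dirDeriv w F)) p = 0 := by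
  have hcomm : dirDeriv v (dirDeriv w F) =ᶠ[𝓝 p] dirDeriv w (dirDeriv v F) :=
    eventuallyEq_of_mem (hS.mem_nhds hp) fun q hq => dirDeriv_comm hS hF hq v w
  calc dirDeriv v (dirDeriv v (dirDeriv w F)) p
      = dirDeriv v (dirDeriv w (dirDeriv v F)) p := by rw [dirDeriv, hcomm.fderiv_eq]; rfl
    _ = dirDeriv w (dirDeriv v (dirDeriv v F)) p :=
        dirDeriv_comm hS (contDiffOn_dirDeriv hS hF v) hp v w
    _ = 0 := dirDeriv_eq_zero_of_const_on hS h hp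

theorem hasDerivAt_comp_line {s : ℝ} (hF : DifferentiableAt ℝ F (p + s • v)) :
    HasDerivAt (fun r : ℝ => F (p + r • v)) (dirDeriv v F (p + s • v)) s := by
  have hline : HasDerivAt (fun r : ℝ => p + r • v) v s := by
    simpa using ((hasDerivAt_id s).smul_const v).const_add p
  exact hF.hasFDerivAt.comp_hasDerivAt s hline

theorem eventually_line_mem (hS : IsOpen S) (hp : p ∈ S) (v : V) :
    ∀ᶠ s : ℝ in 𝓝 0, p + s • v ∈ S := by
  have hline : ContinuousAt (fun s : ℝ => p + s • v) 0 := by fun_prop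
  exact hline.eventually_mem (by simpa using hS.mem_nhds hp)

theorem eventually_line_eq (hS : IsOpen S) (hF : DifferentiableOn ℝ F S)
    (h : ∀ q ∈ S, dirDeriv v F q = 0) (hp : p ∈ S) :
    ∀ᶠ s : ℝ in 𝓝 0, F (p + s • v) = F p := by
  have hd : ∀ᶠ s : ℝ in 𝓝 0, HasDerivAt (fun r : ℝ => F (p + r • v)) 0 s := by
    filter_upwards [eventually_line_mem hS hp v] with s hs
    exact h _ hs ▸ hasDerivAt_comp_line (hF.differentiableAt (hS.mem_nhds hs))
  simpa using eventually_eq_add_smul_of_hasDerivAt hd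

theorem eventually_line_eq_add_smul (hS : IsOpen S) (hF : ContDiffOn ℝ ∞ F S)
    (h : ∀ q ∈ S, dirDeriv v (dirDeriv v F) q = 0) (hp : p ∈ S) :
    ∀ᶠ s : ℝ in 𝓝 0, F (p + s • v) = F p + s • dirDeriv v F p := by
  have hd : ∀ᶠ s : ℝ in 𝓝 0, HasDerivAt (fun r : ℝ => F (p + r • v)) (dirDeriv v F p) s := by
    filter_upwards [eventually_line_mem hS hp v, eventually_line_eq hS
      ((contDiffOn_dirDeriv hS hF v).differentiableOn (by simp)) h hp] with s hs hs'
    exact hs' ▸ hasDerivAt_comp_line (differentiableAt_of_contDiffOn hS hF hs)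
  simpa using eventually_eq_add_smul_of_hasDerivAt hd

theorem dirDeriv_eq_zero_of_sq_eventually_const {f : V → ℝ} (hf : DifferentiableAt ℝ f p)
    (h0 : f p ≠ 0) (h : ∀ᶠ s : ℝ in 𝓝 0, f (p + s • v) ^ 2 = f p ^ 2) : dirDeriv v f p = 0 := by
  have hsq : HasLineDerivAt ℝ (fun q => f q ^ 2) _ p v := (hf.hasFDerivAt.pow 2).hasLineDerivAt v
  have hconst : HasLineDerivAt ℝ (fun q => f q ^ 2) 0 p v :=
    (hasDerivAt_const (0 : ℝ) (f p ^ 2)).congr_of_eventuallyEq h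
  simpa [dirDeriv, h0] using hsq.unique hconst

theorem dirDeriv_comp_fst {θ : ℝ → ℝ} {p : ℝ × V} (hθ : DifferentiableAt ℝ θ p.1) (v : ℝ × V) :
    dirDeriv v (fun q => θ q.1) p = v.1 * deriv θ p.1 := by
  have h : HasFDerivAt (fun q : ℝ × V => θ q.1) _ p :=
    hθ.hasDerivAt.hasFDerivAt.comp p hasFDerivAt_fst
  simp [dirDeriv, h.fderiv]

end DirectionalDerivative

/-! ### Total derivatives -/

/-- The unit vector of the `t`-axis. -/
def et : Base := (1, 0, 0)

/-- The unit vector of the `x`-axis. -/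
def ex : Base := (0, 1, 0)

/-- The unit vector of the `u`-axis. -/
def eu : Base := (0, 0, 1)

local notation "∂ₜ" => dirDeriv et
local notation "∂ₓ" => dirDeriv ex
local notation "∂ᵤ" => dirDeriv eu

section TotalDerivative

theorem fderiv_base_apply {W : Type*} [NormedAddCommGroup W] [NormedSpace ℝ W] (F : Base → W)
    (p : Base) (a b c : ℝ) : fderiv ℝ F p (a, b, c) = a • ∂ₜ F p + b • ∂ₓ F p + c • ∂ᵤ F p := by
  have h : ((a, b, c) : Base) = a • et + b • ex + c • eu := by simp [et, ex, eu]
  rw [h, map_add, map_add, map_smul, map_smul, map_smul]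
  rfl

/-- The projection of the first-order jet space to the base, as a continuous linear map. -/
def baseL : Jet1 →L[ℝ] Base :=
  LinearMap.toContinuousLinearMap ⟨⟨Jet1.base, fun _ _ => rfl⟩, fun _ _ => rfl⟩

/-- The coordinate `u_t` of the first-order jet space, as a continuous linear map. -/
def utL : Jet1 →L[ℝ] ℝ :=
  LinearMap.toContinuousLinearMap ⟨⟨fun j => j.2.2.2.1, fun _ _ => rfl⟩, fun _ _ => rfl⟩

/-- The coordinate `u_x` of the first-order jet space, as a continuous linear map. -/
def uxL : Jet1 →L[ℝ] ℝ :=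
  LinearMap.toContinuousLinearMap ⟨⟨fun j => j.2.2.2.2, fun _ _ => rfl⟩, fun _ _ => rfl⟩

variable {S : Set Base} {F G : Base → ℝ} {j : Jet1}

theorem totalDt0_eq (F : Base → ℝ) (j : Jet1) :
    totalDt0 F j = ∂ₜ F j.base + utL j * ∂ᵤ F j.base := by
  simp [totalDt0, fderiv_base_apply, utL]

theorem totalDx0_eq (F : Base → ℝ) (j : Jet1) :
    totalDx0 F j = ∂ₓ F j.base + uxL j * ∂ᵤ F j.base := by
  simp [totalDx0, fderiv_base_apply, uxL]

theorem hasFDerivAt_base_add_mul (hF : DifferentiableAt ℝ F j.base)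
    (hG : DifferentiableAt ℝ G j.base) (L : Jet1 →L[ℝ] ℝ) :
    HasFDerivAt (fun k : Jet1 => F k.base + L k * G k.base)
      (fderiv ℝ F j.base ∘L baseL + (L j • fderiv ℝ G j.base ∘L baseL + G j.base • L)) j :=
  (hF.hasFDerivAt.comp j baseL.hasFDerivAt).fun_add
    (L.hasFDerivAt.fun_mul (hG.hasFDerivAt.comp j baseL.hasFDerivAt))

theorem hasFDerivAt_totalDt0 (hS : IsOpen S) (hF : ContDiffOn ℝ ∞ F S) (hj : j.base ∈ S) :
    HasFDerivAt (totalDt0 F) (fderiv ℝ (∂ₜ F) j.base ∘L baseL +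
      (utL j • fderiv ℝ (∂ᵤ F) j.base ∘L baseL + ∂ᵤ F j.base • utL)) j := by
  rw [funext (totalDt0_eq F)]
  exact hasFDerivAt_base_add_mul
    (differentiableAt_of_contDiffOn hS (contDiffOn_dirDeriv hS hF et) hj)
    (differentiableAt_of_contDiffOn hS (contDiffOn_dirDeriv hS hF eu) hj) utL

theorem hasFDerivAt_totalDx0 (hS : IsOpen S) (hF : ContDiffOn ℝ ∞ F S) (hj : j.base ∈ S) :
    HasFDerivAt (totalDx0 F) (fderiv ℝ (∂ₓ F) j.base ∘L baseL +
      (uxL j • fderiv ℝ (∂ᵤ F) j.base ∘L baseL + ∂ᵤ F j.base • uxL)) j := by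
  rw [funext (totalDx0_eq F)]
  exact hasFDerivAt_base_add_mul
    (differentiableAt_of_contDiffOn hS (contDiffOn_dirDeriv hS hF ex) hj)
    (differentiableAt_of_contDiffOn hS (contDiffOn_dirDeriv hS hF eu) hj) uxL

theorem totalDx1_totalDx0 (hS : IsOpen S) (hF : ContDiffOn ℝ ∞ F S) {j : Jet2}
    (hj : j.toJet1.base ∈ S) :
    totalDx1 (totalDx0 F) j = ∂ₓ (∂ₓ F) j.toJet1.base + 2 * j.ux * ∂ₓ (∂ᵤ F) j.toJet1.base
      + j.ux ^ 2 * ∂ᵤ (∂ᵤ F) j.toJet1.base + j.uxx * ∂ᵤ F j.toJet1.base := by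
  have hbase : baseL (0, 1, j.ux, j.utx, j.uxx) = (0, 1, j.ux) := rfl
  have hux : uxL (0, 1, j.ux, j.utx, j.uxx) = j.uxx := rfl
  have hux' : uxL j.toJet1 = j.ux := rfl
  rw [totalDx1, (hasFDerivAt_totalDx0 hS hF hj).fderiv]
  simp only [add_apply, smul_apply, ContinuousLinearMap.comp_apply, hbase, hux, hux',
    fderiv_base_apply, smul_eq_mul]
  rw [dirDeriv_comm hS hF hj eu ex]
  ring

theorem hasLineDerivAt_totalDt0_ut (hS : IsOpen S) (hF : ContDiffOn ℝ ∞ F S)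
    (hj : j.base ∈ S) : HasLineDerivAt ℝ (totalDt0 F) (∂ᵤ F j.base) j (0, 0, 0, 1, 0) := by
  have hbase : baseL (0, 0, 0, 1, 0) = 0 := rfl
  have hut : utL (0, 0, 0, 1, 0) = 1 := rfl
  simpa [hbase, hut] using (hasFDerivAt_totalDt0 hS hF hj).hasLineDerivAt (0, 0, 0, 1, 0)

theorem hasLineDerivAt_totalDx0_ut (hS : IsOpen S) (hF : ContDiffOn ℝ ∞ F S)
    (hj : j.base ∈ S) : HasLineDerivAt ℝ (totalDx0 F) 0 j (0, 0, 0, 1, 0) := by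
  have hbase : baseL (0, 0, 0, 1, 0) = 0 := rfl
  have hux : uxL (0, 0, 0, 1, 0) = 0 := rfl
  simpa [hbase, hux] using (hasFDerivAt_totalDx0 hS hF hj).hasLineDerivAt (0, 0, 0, 1, 0)

end TotalDerivative

/-! ### Transformations of equations preserve the time foliation -/

namespace PointTransformation

variable {Φ : PointTransformation Base} {p : Base} {j : Jet1}

theorem contDiffOn_T (Φ : PointTransformation Base) : ContDiffOn ℝ ∞ Φ.T Φ.source :=
  contDiff_fst.comp_contDiffOn Φ.smooth

theorem contDiffOn_X (Φ : PointTransformation Base) : ContDiffOn ℝ ∞ Φ.X Φ.source :=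
  contDiff_fst.comp_contDiffOn (contDiff_snd.comp_contDiffOn Φ.smooth)

theorem contDiffOn_U (Φ : PointTransformation Base) : ContDiffOn ℝ ∞ Φ.U Φ.source :=
  contDiff_snd.comp_contDiffOn (contDiff_snd.comp_contDiffOn Φ.smooth)

theorem fderiv_toFun_apply (hp : p ∈ Φ.source) (v : Base) :
    fderiv ℝ Φ.toFun p v = (fderiv ℝ Φ.T p v, fderiv ℝ Φ.X p v, fderiv ℝ Φ.U p v) := by
  have hS := Φ.isOpen_source
  have h : HasFDerivAt Φ.toFun _ p :=
    (differentiableAt_of_contDiffOn hS Φ.contDiffOn_T hp).hasFDerivAt.prodMk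
      ((differentiableAt_of_contDiffOn hS Φ.contDiffOn_X hp).hasFDerivAt.prodMk
        (differentiableAt_of_contDiffOn hS Φ.contDiffOn_U hp).hasFDerivAt)
  rw [h.fderiv]
  rfl

/-- The Jacobian determinant of the functions `T, X, U` of `(t, x, u)`. -/
def jacobian (Φ : PointTransformation Base) (p : Base) : ℝ :=
  Matrix.det !![∂ₜ Φ.T p, ∂ₜ Φ.X p, ∂ₜ Φ.U p;
                ∂ₓ Φ.T p, ∂ₓ Φ.X p, ∂ₓ Φ.U p;
                ∂ᵤ Φ.T p, ∂ᵤ Φ.X p, ∂ᵤ Φ.U p]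

theorem jacobian_eq (Φ : PointTransformation Base) (p : Base) :
    Φ.jacobian p =
      (∂ₜ Φ.T p * ∂ₓ Φ.X p - ∂ₓ Φ.T p * ∂ₜ Φ.X p) * ∂ᵤ Φ.U p
      - (∂ᵤ Φ.T p * ∂ₓ Φ.X p - ∂ₓ Φ.T p * ∂ᵤ Φ.X p) * ∂ₜ Φ.U p
      - (∂ₜ Φ.T p * ∂ᵤ Φ.X p - ∂ᵤ Φ.T p * ∂ₜ Φ.X p) * ∂ₓ Φ.U p := by
  rw [jacobian, Matrix.det_fin_three]
  simp only [Matrix.of_apply, Matrix.cons_val]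
  ring

theorem jacobian_ne_zero (hp : p ∈ Φ.source) : Φ.jacobian p ≠ 0 := by
  intro h
  obtain ⟨v, hv, hv0⟩ := Matrix.exists_vecMul_eq_zero_iff.2 h
  have hker : fderiv ℝ Φ.toFun p (v 0, v 1, v 2) = 0 := by
    have h0 := congrFun hv0 0
    have h1 := congrFun hv0 1
    have h2 := congrFun hv0 2
    simp only [Matrix.vecMul, dotProduct, Fin.sum_univ_three, Matrix.of_apply, Matrix.cons_val,
      Pi.zero_apply] at h0 h1 h2
    simp [fderiv_toFun_apply hp, fderiv_base_apply, h0, h1, h2]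
  have h0 := (Φ.nondegenerate p hp).injective (hker.trans (map_zero _).symm)
  simp only [Prod.mk_eq_zero] at h0
  exact hv (funext fun i => by fin_cases i <;> simp [h0])

theorem differentiableAt_newUx (hj : j.base ∈ Φ.source) (hJ : Φ.totalJacobian j ≠ 0) :
    DifferentiableAt ℝ Φ.newUx j := by
  have hS := Φ.isOpen_source
  have hTt := (hasFDerivAt_totalDt0 hS Φ.contDiffOn_T hj).differentiableAt
  have hTx := (hasFDerivAt_totalDx0 hS Φ.contDiffOn_T hj).differentiableAt
  have hXt := (hasFDerivAt_totalDt0 hS Φ.contDiffOn_X hj).differentiableAt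
  have hXx := (hasFDerivAt_totalDx0 hS Φ.contDiffOn_X hj).differentiableAt
  have hUt := (hasFDerivAt_totalDt0 hS Φ.contDiffOn_U hj).differentiableAt
  have hUx := (hasFDerivAt_totalDx0 hS Φ.contDiffOn_U hj).differentiableAt
  have hquot : Φ.newUx = fun k => (totalDt0 Φ.T k * totalDx0 Φ.U k -
      totalDx0 Φ.T k * totalDt0 Φ.U k) * (Φ.totalJacobian k)⁻¹ := funext fun _ => div_eq_mul_inv _ _
  rw [hquot]
  exact ((hTt.fun_mul hUx).fun_sub (hTx.fun_mul hUt)).fun_mul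
    (((hTt.fun_mul hXx).fun_sub (hTx.fun_mul hXt)).fun_inv hJ)

theorem fderiv_newUx_ut (hj : j.base ∈ Φ.source) (hJ : Φ.totalJacobian j ≠ 0) :
    fderiv ℝ Φ.newUx j (0, 0, 0, 1, 0) =
      -(totalDx0 Φ.T j * Φ.jacobian j.base) / Φ.totalJacobian j ^ 2 := by
  have hS := Φ.isOpen_source
  have hTt := hasLineDerivAt_totalDt0_ut hS Φ.contDiffOn_T hj
  have hTx := hasLineDerivAt_totalDx0_ut hS Φ.contDiffOn_T hj
  have hXt := hasLineDerivAt_totalDt0_ut hS Φ.contDiffOn_X hj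
  have hXx := hasLineDerivAt_totalDx0_ut hS Φ.contDiffOn_X hj
  have hUt := hasLineDerivAt_totalDt0_ut hS Φ.contDiffOn_U hj
  have hUx := hasLineDerivAt_totalDx0_ut hS Φ.contDiffOn_U hj
  have hquot : HasLineDerivAt ℝ Φ.newUx _ j (0, 0, 0, 1, 0) :=
    ((hTt.fun_mul hUx).fun_sub (hTx.fun_mul hUt)).fun_div
      ((hTt.fun_mul hXx).fun_sub (hTx.fun_mul hXt)) (by simpa using hJ)
  rw [((differentiableAt_newUx hj hJ).hasFDerivAt.hasLineDerivAt _).unique hquot]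
  simp only [zero_smul, add_zero, totalJacobian, totalDt0_eq, totalDx0_eq, jacobian_eq]
  ring

theorem newDx_newUx_utt_add {j : Jet2} (hj : j.toJet1.base ∈ Φ.source)
    (hJ : Φ.totalJacobian j.toJet1 ≠ 0) (s : ℝ) :
    Φ.newDx Φ.newUx { j with utt := j.utt + s } = Φ.newDx Φ.newUx j +
      s * (totalDx0 Φ.T j.toJet1 ^ 2 * Φ.jacobian j.toJet1.base /
        Φ.totalJacobian j.toJet1 ^ 3) := by
  have hjet : ({ j with utt := j.utt + s } : Jet2).toJet1 = j.toJet1 := rfl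
  have hDx : totalDx1 Φ.newUx { j with utt := j.utt + s } = totalDx1 Φ.newUx j := rfl
  have hDt : totalDt1 Φ.newUx { j with utt := j.utt + s } = totalDt1 Φ.newUx j +
      s * fderiv ℝ Φ.newUx j.toJet1 (0, 0, 0, 1, 0) := by
    simp only [totalDt1, hjet]
    rw [← smul_eq_mul, ← map_smul, ← map_add]
    simp
  rw [newDx, newDx, hjet, hDx, hDt, fderiv_newUx_ut hj hJ]
  field_simp
  ring

end PointTransformation

theorem Equation.exists_mem_manifold (E : Equation) {j : Jet1} (hj : j.1 ∈ E.timeDomain) :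
    ∃ k ∈ E.manifold, k.toJet1 = j := by
  obtain ⟨t, x, u, ut, ux⟩ := j
  refine ⟨⟨t, x, u, ut, ux, 0, 0, (ut - E.b t * u + E.c t * u ^ 3) / E.a t ^ 2⟩, ⟨hj, ?_⟩, rfl⟩
  have ha := E.a_ne_zero t hj
  field_simp
  ring

/-- The new time depends, locally, on the old time only: `T_x = T_u = 0`. -/
def PointTransformation.IsTimeFibred (Φ : PointTransformation Base) : Prop :=
  ∀ p ∈ Φ.source, ∂ₓ Φ.T p = 0 ∧ ∂ᵤ Φ.T p = 0

theorem eq_zero_or_eq_zero_of_affine_mul_affine_eq_zero {K : Type*} [Field K] [CharZero K]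
    {a b c₀ c₁ c₂ : K} (h : ∀ r s : K, (a + s * b) * (c₀ + r * c₁ + s * c₂) = 0) :
    (a = 0 ∧ b = 0) ∨ (c₀ = 0 ∧ c₁ = 0 ∧ c₂ = 0) := by
  have h0 : a * c₀ = 0 := by linear_combination h 0 0
  have h1 : a * c₁ = 0 := by linear_combination h 1 0 - h 0 0
  have h2 : b * c₂ = 0 := by linear_combination (h 0 1 + h 0 (-1)) / 2 - h 0 0
  have h3 : a * c₂ + b * c₀ = 0 := by linear_combination (h 0 1 - h 0 (-1)) / 2
  have h4 : b * c₁ = 0 := by linear_combination h 1 1 - h 0 1 - h1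
  grind

namespace MapsEquation

variable {E E' : Equation} {Φ : PointTransformation Base}

theorem totalDx0_T_eq_zero (h : MapsEquation Φ E E') {j : Jet1} (hj : j.base ∈ Φ.source)
    (hJ : Φ.totalJacobian j ≠ 0) : totalDx0 Φ.T j = 0 := by
  obtain ⟨k, hk, rfl⟩ := E.exists_mem_manifold (h.1 _ hj).1
  have hprolong (s : ℝ) : Φ.newUt k.toJet1 = E'.a (Φ.T k.toJet1.base) ^ 2 *
        Φ.newDx Φ.newUx { k with utt := k.utt + s } +
      E'.b (Φ.T k.toJet1.base) * Φ.U k.toJet1.base -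
        E'.c (Φ.T k.toJet1.base) * Φ.U k.toJet1.base ^ 3 :=
    ((h.2 { k with utt := k.utt + s } hj hJ).1 hk).2
  have hcoeff : E'.a (Φ.T k.toJet1.base) ^ 2 *
      (totalDx0 Φ.T k.toJet1 ^ 2 * Φ.jacobian k.toJet1.base /
        Φ.totalJacobian k.toJet1 ^ 3) = 0 := by
    have h0 := hprolong 0
    have h1 := hprolong 1
    rw [PointTransformation.newDx_newUx_utt_add hj hJ] at h0 h1
    linear_combination h0 - h1
  simpa [E'.a_ne_zero _ (h.1 _ hj).2, PointTransformation.jacobian_ne_zero hj, hJ] using hcoeff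

theorem isTimeFibred (h : MapsEquation Φ E E') : Φ.IsTimeFibred := by
  intro p hp
  have hmul (ut ux : ℝ) : (∂ₓ Φ.T p + ux * ∂ᵤ Φ.T p) *
      ((∂ₜ Φ.T p * ∂ₓ Φ.X p - ∂ₓ Φ.T p * ∂ₜ Φ.X p) +
        ut * (∂ᵤ Φ.T p * ∂ₓ Φ.X p - ∂ₓ Φ.T p * ∂ᵤ Φ.X p) +
        ux * (∂ₜ Φ.T p * ∂ᵤ Φ.X p - ∂ᵤ Φ.T p * ∂ₜ Φ.X p)) = 0 := by
    let j : Jet1 := (p.1, p.2.1, p.2.2, ut, ux)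
    have hDx (F : Base → ℝ) : totalDx0 F j = ∂ₓ F p + ux * ∂ᵤ F p := totalDx0_eq F j
    have hDt (F : Base → ℝ) : totalDt0 F j = ∂ₜ F p + ut * ∂ᵤ F p := totalDt0_eq F j
    have hzero : totalDx0 Φ.T j * Φ.totalJacobian j = 0 :=
      or_iff_not_imp_right.2 (h.totalDx0_T_eq_zero (j := j) hp) |> mul_eq_zero.2
    rw [PointTransformation.totalJacobian, hDx, hDx, hDt, hDt] at hzero
    linear_combination hzero
  refine (eq_zero_or_eq_zero_of_affine_mul_affine_eq_zero hmul).resolve_right ?_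
  rintro ⟨h0, h1, h2⟩
  apply PointTransformation.jacobian_ne_zero hp
  rw [Φ.jacobian_eq, h0, h1, h2]
  ring

end MapsEquation

/-! ### Prolongation of time-fibred transformations -/

namespace PointTransformation.IsTimeFibred

variable {Φ : PointTransformation Base} {p v : Base} {j : Jet1}

theorem dirDeriv_T (h : Φ.IsTimeFibred) (hp : p ∈ Φ.source) (v : Base) :
    dirDeriv v Φ.T p = v.1 * ∂ₜ Φ.T p := by
  obtain ⟨a, b, c⟩ := v
  simp [dirDeriv.eq_def (a, b, c), fderiv_base_apply, h p hp]

theorem dirDeriv_et_T_ne_zero (h : Φ.IsTimeFibred) (hp : p ∈ Φ.source) : ∂ₜ Φ.T p ≠ 0 := by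
  intro h0
  apply jacobian_ne_zero hp
  rw [jacobian_eq, h0, (h p hp).1, (h p hp).2]
  ring

theorem totalDt0_T (h : Φ.IsTimeFibred) (hj : j.base ∈ Φ.source) :
    totalDt0 Φ.T j = ∂ₜ Φ.T j.base := by
  rw [totalDt0_eq, (h _ hj).2, mul_zero, add_zero]

theorem totalDx0_T (h : Φ.IsTimeFibred) (hj : j.base ∈ Φ.source) : totalDx0 Φ.T j = 0 := by
  rw [totalDx0_eq, (h _ hj).1, (h _ hj).2, mul_zero, add_zero]

theorem totalJacobian_eq (h : Φ.IsTimeFibred) (hj : j.base ∈ Φ.source) :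
    Φ.totalJacobian j = ∂ₜ Φ.T j.base * totalDx0 Φ.X j := by
  rw [totalJacobian, h.totalDt0_T hj, h.totalDx0_T hj, zero_mul, sub_zero]

theorem newUt_eq (h : Φ.IsTimeFibred) (hj : j.base ∈ Φ.source) :
    Φ.newUt j = (totalDx0 Φ.X j * totalDt0 Φ.U j - totalDt0 Φ.X j * totalDx0 Φ.U j) /
      (∂ₜ Φ.T j.base * totalDx0 Φ.X j) := by
  rw [newUt, h.totalJacobian_eq hj]

theorem newUx_eq (h : Φ.IsTimeFibred) (hj : j.base ∈ Φ.source) :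
    Φ.newUx j = totalDx0 Φ.U j / totalDx0 Φ.X j := by
  rw [newUx, h.totalJacobian_eq hj, h.totalDt0_T hj, h.totalDx0_T hj, zero_mul, sub_zero,
    mul_div_mul_left _ _ (h.dirDeriv_et_T_ne_zero hj)]

theorem newDx_newUx_eq (h : Φ.IsTimeFibred) {j : Jet2} (hj : j.toJet1.base ∈ Φ.source)
    (hX : totalDx0 Φ.X j.toJet1 ≠ 0) :
    Φ.newDx Φ.newUx j =
      (totalDx1 (totalDx0 Φ.U) j * totalDx0 Φ.X j.toJet1 -
        totalDx0 Φ.U j.toJet1 * totalDx1 (totalDx0 Φ.X) j) / totalDx0 Φ.X j.toJet1 ^ 3 := by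
  have hTt := h.dirDeriv_et_T_ne_zero hj
  have hJ : Φ.totalJacobian j.toJet1 ≠ 0 := by
    rw [h.totalJacobian_eq hj]
    exact mul_ne_zero hTt hX
  have hev : Φ.newUx =ᶠ[𝓝 j.toJet1] fun k => totalDx0 Φ.U k / totalDx0 Φ.X k := by
    filter_upwards [baseL.continuous.continuousAt.eventually_mem (Φ.isOpen_source.mem_nhds hj)]
      with k hk using h.newUx_eq hk
  let v : Jet1 := (0, 1, j.ux, j.utx, j.uxx)
  have hU := (hasFDerivAt_totalDx0 Φ.isOpen_source Φ.contDiffOn_U hj).differentiableAt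
  have hX' := (hasFDerivAt_totalDx0 Φ.isOpen_source Φ.contDiffOn_X hj).differentiableAt
  have hquot : HasLineDerivAt ℝ (fun k => totalDx0 Φ.U k / totalDx0 Φ.X k) _ j.toJet1 v :=
    (hU.hasFDerivAt.hasLineDerivAt v).fun_div (hX'.hasFDerivAt.hasLineDerivAt v)
      (by simpa using hX)
  have hDx : totalDx1 Φ.newUx j = _ :=
    ((differentiableAt_newUx hj hJ).hasFDerivAt.hasLineDerivAt v).unique
      (hquot.congr_of_eventuallyEq hev)
  rw [newDx, hDx, h.totalJacobian_eq hj, h.totalDt0_T hj, h.totalDx0_T hj, totalDx1, totalDx1]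
  simp only [zero_smul, add_zero]
  field_simp
  ring

theorem eventually_line (h : Φ.IsTimeFibred) (hp : p ∈ Φ.source) (hv : v.1 = 0) :
    ∀ᶠ s : ℝ in 𝓝 0, p + s • v ∈ Φ.source ∧ (p + s • v).1 = p.1 ∧ Φ.T (p + s • v) = Φ.T p ∧
      ∂ₜ Φ.T (p + s • v) = ∂ₜ Φ.T p := by
  have hS := Φ.isOpen_source
  have hT := Φ.contDiffOn_T
  have hvT : ∀ q ∈ Φ.source, dirDeriv v Φ.T q = 0 := fun q hq => by
    rw [h.dirDeriv_T hq, hv, zero_mul]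
  filter_upwards [eventually_line_mem hS hp v,
    eventually_line_eq hS (hT.differentiableOn (by simp)) hvT hp,
    eventually_line_eq hS ((contDiffOn_dirDeriv hS hT et).differentiableOn (by simp))
      (fun q hq => dirDeriv_dirDeriv_eq_zero hS hT hvT hq et) hp] with s hs hsT hsTt
  exact ⟨hs, by simp [hv], hsT, hsTt⟩

end PointTransformation.IsTimeFibred

/-! ### The determining equations -/

/-- A second-order jet over `p` that lies on the manifold of `E` and has the prescribed values of
`u_x` and `u_xx`; the remaining free coordinates `u_tt` and `u_tx` are set to `0`. -/
def Equation.jet (E : Equation) (p : Base) (ux uxx : ℝ) : Jet2 where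
  t := p.1
  x := p.2.1
  u := p.2.2
  ut := E.a p.1 ^ 2 * uxx + E.b p.1 * p.2.2 - E.c p.1 * p.2.2 ^ 3
  ux := ux
  utt := 0
  utx := 0
  uxx := uxx

theorem cubic_eq_zero_of_eventually_eval_eq_zero {P : Cubic ℝ} {a : ℝ}
    (h : ∀ᶠ s in 𝓝 a, P.toPoly.eval s = 0) : P = 0 :=
  (Cubic.toPoly_eq_zero_iff P).1 <|
    Polynomial.eq_zero_of_infinite_isRoot _ (infinite_of_mem_nhds a h)

theorem eq_of_eventually_add_mul_eq_cube_sub_cube {k₀ k₁ γ κ u v w : ℝ} (hκ : κ ≠ 0) (hv : v ≠ 0)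
    (h : ∀ᶠ s in 𝓝 0, k₀ + k₁ * s = γ * (u + s) ^ 3 - κ * (w + s * v) ^ 3) :
    γ = κ * v ^ 3 ∧ w = u * v := by
  have hcubic := cubic_eq_zero_of_eventually_eval_eq_zero (a := 0) (P := ⟨γ - κ * v ^ 3,
    3 * (γ * u - κ * v ^ 2 * w), 3 * (γ * u ^ 2 - κ * v * w ^ 2) - k₁,
    γ * u ^ 3 - κ * w ^ 3 - k₀⟩) <| by
    filter_upwards [h] with s hs
    simp only [Cubic.toPoly, Polynomial.eval_add, Polynomial.eval_mul, Polynomial.eval_C,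
      Polynomial.eval_pow, Polynomial.eval_X]
    linear_combination -hs
  obtain ⟨hs3, hs2, -, -⟩ := Cubic.ext_iff.1 hcubic
  change γ - κ * v ^ 3 = 0 at hs3
  change 3 * (γ * u - κ * v ^ 2 * w) = 0 at hs2
  have hw : κ * v ^ 2 * (u * v - w) = 0 := by linear_combination hs2 / 3 - u * hs3
  refine ⟨sub_eq_zero.1 hs3, ?_⟩
  simpa [hκ, hv, sub_eq_zero, eq_comm] using hw

namespace MapsEquation

variable {E E' : Equation} {Φ : PointTransformation Base} {p : Base}

theorem determining_eq (h : MapsEquation Φ E E') {k : Jet2} (hk : k ∈ E.manifold)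
    (hp : k.toJet1.base ∈ Φ.source) (hX : totalDx0 Φ.X k.toJet1 ≠ 0) :
    totalDx0 Φ.X k.toJet1 ^ 2 * (totalDx0 Φ.X k.toJet1 * totalDt0 Φ.U k.toJet1 -
        totalDt0 Φ.X k.toJet1 * totalDx0 Φ.U k.toJet1) =
      ∂ₜ Φ.T k.toJet1.base * (E'.a (Φ.T k.toJet1.base) ^ 2 *
          (totalDx1 (totalDx0 Φ.U) k * totalDx0 Φ.X k.toJet1 -
            totalDx0 Φ.U k.toJet1 * totalDx1 (totalDx0 Φ.X) k) +
        totalDx0 Φ.X k.toJet1 ^ 3 * (E'.b (Φ.T k.toJet1.base) * Φ.U k.toJet1.base -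
          E'.c (Φ.T k.toJet1.base) * Φ.U k.toJet1.base ^ 3)) := by
  have hfib := h.isTimeFibred
  have hTt := hfib.dirDeriv_et_T_ne_zero hp
  have hJ : Φ.totalJacobian k.toJet1 ≠ 0 := by
    rw [hfib.totalJacobian_eq hp]
    exact mul_ne_zero hTt hX
  have heq : Φ.newUt k.toJet1 = E'.a (Φ.T k.toJet1.base) ^ 2 * Φ.newDx Φ.newUx k +
      E'.b (Φ.T k.toJet1.base) * Φ.U k.toJet1.base -
        E'.c (Φ.T k.toJet1.base) * Φ.U k.toJet1.base ^ 3 := ((h.2 k hp hJ).1 hk).2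
  rw [hfib.newUt_eq hp, hfib.newDx_newUx_eq hp hX] at heq
  field_simp at heq
  linear_combination heq

theorem determining_eq_jet (h : MapsEquation Φ E E') (hp : p ∈ Φ.source) (ux uxx : ℝ) {W : ℝ}
    (hW : ∂ₓ Φ.X p + ux * ∂ᵤ Φ.X p = W) (hW0 : W ≠ 0) :
    W ^ 2 * (W * (∂ₜ Φ.U p +
          (E.a p.1 ^ 2 * uxx + E.b p.1 * p.2.2 - E.c p.1 * p.2.2 ^ 3) * ∂ᵤ Φ.U p) -
        (∂ₜ Φ.X p + (E.a p.1 ^ 2 * uxx + E.b p.1 * p.2.2 - E.c p.1 * p.2.2 ^ 3) * ∂ᵤ Φ.X p) *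
          (∂ₓ Φ.U p + ux * ∂ᵤ Φ.U p)) =
      ∂ₜ Φ.T p * (E'.a (Φ.T p) ^ 2 *
          ((∂ₓ (∂ₓ Φ.U) p + 2 * ux * ∂ₓ (∂ᵤ Φ.U) p + ux ^ 2 * ∂ᵤ (∂ᵤ Φ.U) p +
              uxx * ∂ᵤ Φ.U p) * W -
            (∂ₓ Φ.U p + ux * ∂ᵤ Φ.U p) *
              (∂ₓ (∂ₓ Φ.X) p + 2 * ux * ∂ₓ (∂ᵤ Φ.X) p + ux ^ 2 * ∂ᵤ (∂ᵤ Φ.X) p +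
                uxx * ∂ᵤ Φ.X p)) +
        W ^ 3 * (E'.b (Φ.T p) * Φ.U p - E'.c (Φ.T p) * Φ.U p ^ 3)) := by
  let k := E.jet p ux uxx
  have hDxX : totalDx0 Φ.X k.toJet1 = W := (totalDx0_eq _ _).trans hW
  have heq := h.determining_eq (k := k) ⟨(h.1 p hp).1, rfl⟩ hp (hDxX ▸ hW0)
  rw [hDxX, totalDx1_totalDx0 (j := k) Φ.isOpen_source Φ.contDiffOn_U hp,
    totalDx1_totalDx0 (j := k) Φ.isOpen_source Φ.contDiffOn_X hp, totalDt0_eq, totalDt0_eq,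
    totalDx0_eq] at heq
  exact heq

theorem sq_totalDx0_X_eq (h : MapsEquation Φ E E') (hp : p ∈ Φ.source) {ux W : ℝ}
    (hW : ∂ₓ Φ.X p + ux * ∂ᵤ Φ.X p = W) (hW0 : W ≠ 0) :
    E.a p.1 ^ 2 * W ^ 2 = E'.a (Φ.T p) ^ 2 * ∂ₜ Φ.T p := by
  have hT := h.isTimeFibred p hp
  have hD : ∂ₓ Φ.X p * ∂ᵤ Φ.U p - ∂ᵤ Φ.X p * ∂ₓ Φ.U p ≠ 0 := by
    refine fun h0 => PointTransformation.jacobian_ne_zero hp ?_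
    rw [Φ.jacobian_eq, hT.1, hT.2]
    linear_combination ∂ₜ Φ.T p * h0
  apply mul_right_cancel₀ hD
  linear_combination h.determining_eq_jet hp ux 1 hW hW0 - h.determining_eq_jet hp ux 0 hW hW0 +
    (E.a p.1 ^ 2 * W ^ 2 - E'.a (Φ.T p) ^ 2 * ∂ₜ Φ.T p) * ∂ᵤ Φ.U p * hW

theorem dirDeriv_eu_X (h : MapsEquation Φ E E') (hp : p ∈ Φ.source) : ∂ᵤ Φ.X p = 0 := by
  by_contra hXu
  have hsq {W : ℝ} (hW0 : W ≠ 0) : E.a p.1 ^ 2 * W ^ 2 = E'.a (Φ.T p) ^ 2 * ∂ₜ Φ.T p :=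
    h.sq_totalDx0_X_eq hp (ux := (W - ∂ₓ Φ.X p) / ∂ᵤ Φ.X p) (by field_simp; ring) hW0
  have ha : E.a p.1 ^ 2 = 0 := by linarith [hsq one_ne_zero, hsq (two_ne_zero (α := ℝ))]
  exact E.a_ne_zero _ (h.1 p hp).1 (pow_eq_zero_iff two_ne_zero |>.1 ha)

theorem jacobian_eq_mul (h : MapsEquation Φ E E') (hp : p ∈ Φ.source) :
    Φ.jacobian p = ∂ₜ Φ.T p * ∂ₓ Φ.X p * ∂ᵤ Φ.U p := by
  rw [Φ.jacobian_eq, (h.isTimeFibred p hp).1, (h.isTimeFibred p hp).2, h.dirDeriv_eu_X hp]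
  ring

theorem dirDeriv_ex_X_ne_zero (h : MapsEquation Φ E E') (hp : p ∈ Φ.source) : ∂ₓ Φ.X p ≠ 0 :=
  right_ne_zero_of_mul
    (left_ne_zero_of_mul (h.jacobian_eq_mul hp ▸ PointTransformation.jacobian_ne_zero hp))

theorem dirDeriv_eu_U_ne_zero (h : MapsEquation Φ E E') (hp : p ∈ Φ.source) : ∂ᵤ Φ.U p ≠ 0 :=
  right_ne_zero_of_mul (h.jacobian_eq_mul hp ▸ PointTransformation.jacobian_ne_zero hp)

theorem sq_dirDeriv_ex_X_eq (h : MapsEquation Φ E E') (hp : p ∈ Φ.source) :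
    E.a p.1 ^ 2 * ∂ₓ Φ.X p ^ 2 = E'.a (Φ.T p) ^ 2 * ∂ₜ Φ.T p :=
  h.sq_totalDx0_X_eq hp (ux := 0) (by ring) (h.dirDeriv_ex_X_ne_zero hp)

theorem dirDeriv_ex_ex_X (h : MapsEquation Φ E E') (hp : p ∈ Φ.source) : ∂ₓ (∂ₓ Φ.X) p = 0 := by
  have hS := Φ.isOpen_source
  refine dirDeriv_eq_zero_of_sq_eventually_const
    (differentiableAt_of_contDiffOn hS (contDiffOn_dirDeriv hS Φ.contDiffOn_X ex) hp)
    (h.dirDeriv_ex_X_ne_zero hp) ?_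
  filter_upwards [h.isTimeFibred.eventually_line hp (v := ex) rfl] with s ⟨hs, ht, hT, hTt⟩
  have hsq := h.sq_dirDeriv_ex_X_eq hs
  rw [ht, hT, hTt, ← h.sq_dirDeriv_ex_X_eq hp] at hsq
  exact mul_left_cancel₀ (pow_ne_zero 2 (E.a_ne_zero _ (h.1 _ hp).1)) hsq

theorem reduced_determining_eq (h : MapsEquation Φ E E') (hp : p ∈ Φ.source) (ux : ℝ) :
    ∂ₓ Φ.X p * (∂ₜ Φ.U p + (E.b p.1 * p.2.2 - E.c p.1 * p.2.2 ^ 3) * ∂ᵤ Φ.U p) -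
        ∂ₜ Φ.X p * (∂ₓ Φ.U p + ux * ∂ᵤ Φ.U p) =
      ∂ₓ Φ.X p * (E.a p.1 ^ 2 *
          (∂ₓ (∂ₓ Φ.U) p + 2 * ux * ∂ₓ (∂ᵤ Φ.U) p + ux ^ 2 * ∂ᵤ (∂ᵤ Φ.U) p) +
        ∂ₜ Φ.T p * (E'.b (Φ.T p) * Φ.U p - E'.c (Φ.T p) * Φ.U p ^ 3)) := by
  have hX := h.dirDeriv_ex_X_ne_zero hp
  have hS := Φ.isOpen_source
  have hzero (w : Base) : ∂ᵤ (dirDeriv w Φ.X) p = 0 := by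
    rw [dirDeriv_comm hS Φ.contDiffOn_X hp]
    exact dirDeriv_eq_zero_of_const_on hS (fun _ hq => h.dirDeriv_eu_X hq) hp
  have hXxu : ∂ₓ (∂ᵤ Φ.X) p = 0 :=
    dirDeriv_eq_zero_of_const_on hS (fun _ hq => h.dirDeriv_eu_X hq) hp
  have heq := h.determining_eq_jet hp ux 0 (W := ∂ₓ Φ.X p)
    (by rw [h.dirDeriv_eu_X hp, mul_zero, add_zero]) hX
  rw [h.dirDeriv_eu_X hp, h.dirDeriv_ex_ex_X hp, hXxu, hzero eu] at heq
  apply mul_left_cancel₀ (pow_ne_zero 2 hX)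
  linear_combination heq - ∂ₓ Φ.X p * (∂ₓ (∂ₓ Φ.U) p + 2 * ux * ∂ₓ (∂ᵤ Φ.U) p +
    ux ^ 2 * ∂ᵤ (∂ᵤ Φ.U) p) * h.sq_dirDeriv_ex_X_eq hp

theorem dirDeriv_eu_eu_U (h : MapsEquation Φ E E') (hp : p ∈ Φ.source) : ∂ᵤ (∂ᵤ Φ.U) p = 0 := by
  have hprod : ∂ₓ Φ.X p * E.a p.1 ^ 2 * ∂ᵤ (∂ᵤ Φ.U) p = 0 := by
    linear_combination h.reduced_determining_eq hp 0 - (h.reduced_determining_eq hp 1 +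
      h.reduced_determining_eq hp (-1)) / 2
  simpa [h.dirDeriv_ex_X_ne_zero hp, E.a_ne_zero _ (h.1 p hp).1] using hprod

theorem dirDeriv_et_X_mul_eq (h : MapsEquation Φ E E') (hp : p ∈ Φ.source) :
    ∂ₜ Φ.X p * ∂ᵤ Φ.U p = -(2 * E.a p.1 ^ 2 * ∂ₓ Φ.X p * ∂ₓ (∂ᵤ Φ.U) p) := by
  linear_combination (h.reduced_determining_eq hp (-1) - h.reduced_determining_eq hp 1) / 2

-- Along the `u`-axis all functions of `Φ` in the determining equation are affine in `u`, so only
-- the two cubic nonlinearities contribute terms of higher order.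
theorem exists_eventually_add_mul_eq_cube_sub_cube (h : MapsEquation Φ E E')
    (hp : p ∈ Φ.source) : ∃ k₀ k₁ : ℝ, ∀ᶠ s : ℝ in 𝓝 0, k₀ + k₁ * s =
      ∂ₓ Φ.X p * E.c p.1 * ∂ᵤ Φ.U p * (p.2.2 + s) ^ 3 -
        ∂ₓ Φ.X p * ∂ₜ Φ.T p * E'.c (Φ.T p) * (Φ.U p + s * ∂ᵤ Φ.U p) ^ 3 := by
  have hS := Φ.isOpen_source
  have hU := Φ.contDiffOn_U
  have hX := Φ.contDiffOn_X
  have hXu : ∀ q ∈ Φ.source, ∂ᵤ Φ.X q = 0 := fun _ hq => h.dirDeriv_eu_X hq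
  have hUuu : ∀ q ∈ Φ.source, ∂ᵤ (∂ᵤ Φ.U) q = 0 := fun _ hq => h.dirDeriv_eu_eu_U hq
  have hUwuu (w : Base) : ∀ q ∈ Φ.source, ∂ᵤ (∂ᵤ (dirDeriv w Φ.U)) q = 0 :=
    fun _ hq => dirDeriv_dirDeriv_dirDeriv_eq_zero hS hU hUuu hq w
  have hUx := contDiffOn_dirDeriv hS hU ex
  have hX_line (w : Base) := eventually_line_eq hS
    ((contDiffOn_dirDeriv hS hX w).differentiableOn (by simp))
    (fun _ hq => dirDeriv_dirDeriv_eq_zero hS hX hXu hq w) hp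
  have hU_line (w : Base) := eventually_line_eq_add_smul hS (contDiffOn_dirDeriv hS hU w)
    (hUwuu w) hp
  have hUxx_line := eventually_line_eq_add_smul hS (contDiffOn_dirDeriv hS hUx ex)
    (fun _ hq => dirDeriv_dirDeriv_dirDeriv_eq_zero hS hUx (hUwuu ex) hq ex) hp
  refine ⟨∂ₓ Φ.X p * (∂ₜ Φ.U p + E.b p.1 * p.2.2 * ∂ᵤ Φ.U p - E.a p.1 ^ 2 * ∂ₓ (∂ₓ Φ.U) p -
      ∂ₜ Φ.T p * E'.b (Φ.T p) * Φ.U p) - ∂ₜ Φ.X p * ∂ₓ Φ.U p,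
    ∂ₓ Φ.X p * (∂ᵤ (∂ₜ Φ.U) p + E.b p.1 * ∂ᵤ Φ.U p - E.a p.1 ^ 2 * ∂ᵤ (∂ₓ (∂ₓ Φ.U)) p -
      ∂ₜ Φ.T p * E'.b (Φ.T p) * ∂ᵤ Φ.U p) - ∂ₜ Φ.X p * ∂ᵤ (∂ₓ Φ.U) p, ?_⟩
  filter_upwards [h.isTimeFibred.eventually_line hp (v := eu) rfl, hX_line et, hX_line ex,
    eventually_line_eq_add_smul hS hU hUuu hp, hU_line et, hU_line ex, hU_line eu, hUxx_line]
    with s ⟨hs, ht, hT, hTt⟩ hXt hXx hU hUt hUx hUu hUxx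
  have hu : (p + s • eu).2.2 = p.2.2 + s := by simp [eu]
  have heq := h.reduced_determining_eq hs 0
  rw [hUuu p hp, smul_zero, add_zero] at hUu
  rw [ht, hT, hTt, hu, hXt, hXx, hU, hUt, hUx, hUu, hUxx] at heq
  simp only [smul_eq_mul] at heq
  linear_combination heq

theorem U_eq_and_c_eq (h : MapsEquation Φ E E') (hp : p ∈ Φ.source) :
    Φ.U p = p.2.2 * ∂ᵤ Φ.U p ∧ E.c p.1 = ∂ₜ Φ.T p * E'.c (Φ.T p) * ∂ᵤ Φ.U p ^ 2 := by
  have hXx := h.dirDeriv_ex_X_ne_zero hp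
  have hTt := h.isTimeFibred.dirDeriv_et_T_ne_zero hp
  have hUu := h.dirDeriv_eu_U_ne_zero hp
  obtain ⟨k₀, k₁, hcubic⟩ := h.exists_eventually_add_mul_eq_cube_sub_cube hp
  obtain ⟨hc, hU⟩ := eq_of_eventually_add_mul_eq_cube_sub_cube
    (mul_ne_zero (mul_ne_zero hXx hTt) (E'.c_ne_zero _ (h.1 p hp).2)) hUu hcubic
  refine ⟨hU, mul_left_cancel₀ (mul_ne_zero hXx hUu) ?_⟩
  linear_combination hc

theorem dirDeriv_ex_eu_U (h : MapsEquation Φ E E') (hp : p ∈ Φ.source) : ∂ₓ (∂ᵤ Φ.U) p = 0 := by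
  have hS := Φ.isOpen_source
  refine dirDeriv_eq_zero_of_sq_eventually_const
    (differentiableAt_of_contDiffOn hS (contDiffOn_dirDeriv hS Φ.contDiffOn_U eu) hp)
    (h.dirDeriv_eu_U_ne_zero hp) ?_
  filter_upwards [h.isTimeFibred.eventually_line hp (v := ex) rfl] with s ⟨hs, ht, hT, hTt⟩
  have hc := (h.U_eq_and_c_eq hs).2
  rw [ht, hT, hTt, (h.U_eq_and_c_eq hp).2] at hc
  exact (mul_left_cancel₀ (mul_ne_zero (h.isTimeFibred.dirDeriv_et_T_ne_zero hp)
    (E'.c_ne_zero _ (h.1 _ hp).2)) hc).symm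

theorem dirDeriv_et_X (h : MapsEquation Φ E E') (hp : p ∈ Φ.source) : ∂ₜ Φ.X p = 0 := by
  have hprod := h.dirDeriv_et_X_mul_eq hp
  rw [h.dirDeriv_ex_eu_U hp, mul_zero, neg_zero] at hprod
  exact (mul_eq_zero.1 hprod).resolve_right (h.dirDeriv_eu_U_ne_zero hp)

end MapsEquation

/-! ### From local to global -/

theorem exists_antiderivative {D : Set ℝ} (hD : IsOpen D) (hc : IsConnected D) {f : ℝ → ℝ}
    (hf : ContinuousOn f D) : ∃ F : ℝ → ℝ, ∀ t ∈ D, HasDerivAt F (f t) t := by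
  obtain ⟨t₀, ht₀⟩ := hc.nonempty
  refine ⟨fun t => ∫ s in t₀..t, f s, fun t ht => ?_⟩
  have hsub : uIcc t₀ t ⊆ D := hc.isPreconnected.ordConnected.uIcc_subset ht₀ ht
  exact intervalIntegral.integral_hasDerivAt_right (hf.mono hsub).intervalIntegrable
    (hf.stronglyMeasurableAtFilter hD t ht) (hf.continuousAt (hD.mem_nhds ht))

theorem injOn_of_hasDerivAt_pos {D : Set ℝ} (hc : IsPreconnected D) {F f : ℝ → ℝ}
    (hF : ∀ t ∈ D, HasDerivAt F (f t) t) (hpos : ∀ t ∈ D, 0 < f t) : InjOn F D :=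
  (strictMonoOn_of_deriv_pos hc.ordConnected.convex
    (fun t ht => (hF t ht).continuousAt.continuousWithinAt) fun t ht => by
      rw [(hF t (interior_subset ht)).deriv]
      exact hpos t (interior_subset ht)).injOn

theorem eq_of_sq_eq_sq_of_isPreconnected {X : Type*} [TopologicalSpace X] {S : Set X} {f : X → ℝ}
    (hS : IsPreconnected S) (hf : ContinuousOn f S) (h0 : ∀ p ∈ S, f p ≠ 0) {p q : X} (hp : p ∈ S)
    (hq : q ∈ S) (h : f p ^ 2 = f q ^ 2) : f p = f q := by
  refine (sq_eq_sq_iff_eq_or_eq_neg.1 h).resolve_right fun hneg => ?_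
  have hmem : (0 : ℝ) ∈ uIcc (f p) (f q) := by
    rw [hneg, mem_uIcc, neg_nonpos, Left.nonneg_neg_iff]
    exact (le_total 0 (f q)).imp (fun h => ⟨h, h⟩) fun h => ⟨h, h⟩
  obtain ⟨r, hr, hr0⟩ := (hS.image f hf).ordConnected.uIcc_subset (mem_image_of_mem f hp)
    (mem_image_of_mem f hq) hmem
  exact h0 r hr hr0

theorem exists_contDiffOn_comp_fst_eq {V₁ V₂ W : Type*} [NormedAddCommGroup V₁] [NormedSpace ℝ V₁]
    [NormedAddCommGroup V₂] [NormedSpace ℝ V₂] [NormedAddCommGroup W] [NormedSpace ℝ W]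
    {S : Set (V₁ × V₂)} {F : V₁ × V₂ → W} (hS : IsOpen S) (hF : ContDiffOn ℝ ∞ F S)
    (h : ∀ p ∈ S, ∀ q ∈ S, p.1 = q.1 → F p = F q) :
    ∃ θ : V₁ → W, ContDiffOn ℝ ∞ θ (Prod.fst '' S) ∧ ∀ p ∈ S, F p = θ p.1 := by
  choose! g hgS hg using fun (t : V₁) (ht : t ∈ Prod.fst '' S) => ht
  have hθ : ∀ p ∈ S, F p = F (g p.1) := fun p hp =>
    h p hp _ (hgS p.1 (mem_image_of_mem _ hp)) (hg p.1 (mem_image_of_mem _ hp)).symm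
  refine ⟨fun t => F (g t), ?_, hθ⟩
  rintro _ ⟨p, hp, rfl⟩
  have hslice : ContDiff ℝ ∞ fun s : V₁ => (s, p.2) := by fun_prop
  have hmem : ∀ᶠ s in 𝓝 p.1, (s, p.2) ∈ S :=
    hslice.continuous.continuousAt.eventually_mem (hS.mem_nhds hp)
  have hsmooth : ContDiffAt ℝ ∞ (fun s : V₁ => F (s, p.2)) p.1 :=
    (hF.contDiffAt (hS.mem_nhds hp)).comp p.1 hslice.contDiffAt
  refine (hsmooth.congr_of_eventuallyEq ?_).contDiffWithinAt
  filter_upwards [hmem] with s hs using (hθ _ hs).symm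

theorem differentiableAt_of_contDiffOn_image_fst {S : Set Base} (hS : IsOpen S) {f : ℝ → ℝ}
    (hf : ContDiffOn ℝ ∞ f (Prod.fst '' S)) {p : Base} (hp : p ∈ S) : DifferentiableAt ℝ f p.1 :=
  differentiableAt_of_contDiffOn (isOpenMap_fst S hS) hf (mem_image_of_mem _ hp)

namespace MapsEquation

variable {E E' : Equation} {Φ : PointTransformation Base}

theorem exists_dirDeriv_ex_X_eq (h : MapsEquation Φ E E') (hc : IsPreconnected Φ.source) :
    ∃ δ₁ : ℝ, ∀ p ∈ Φ.source, ∂ₓ Φ.X p = δ₁ := by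
  have hS := Φ.isOpen_source
  have hX := Φ.contDiffOn_X
  refine hS.exists_is_const_of_fderiv_eq_zero hc
    ((contDiffOn_dirDeriv hS hX ex).differentiableOn (by simp)) fun p hp => ?_
  refine ContinuousLinearMap.ext fun ⟨a, b, c⟩ => ?_
  rw [fderiv_base_apply, dirDeriv_dirDeriv_eq_zero hS hX (fun q hq => h.dirDeriv_et_X hq) hp,
    dirDeriv_dirDeriv_eq_zero hS hX (fun q hq => h.dirDeriv_eu_X hq) hp, h.dirDeriv_ex_ex_X hp]
  simp

theorem exists_X_eq (h : MapsEquation Φ E E') (hc : IsPreconnected Φ.source) {δ₁ : ℝ}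
    (hδ : ∀ p ∈ Φ.source, ∂ₓ Φ.X p = δ₁) : ∃ δ₂ : ℝ, ∀ p ∈ Φ.source, Φ.X p = δ₁ * p.2.1 + δ₂ := by
  refine Φ.isOpen_source.exists_eq_add_of_fderiv_eq hc
    (Φ.contDiffOn_X.differentiableOn (by simp)) (g := fun q => δ₁ * q.2.1) (by fun_prop)
    fun p hp => ?_
  have hlin : HasFDerivAt (fun q : Base => δ₁ * q.2.1)
      (δ₁ • (ContinuousLinearMap.fst ℝ ℝ ℝ ∘L ContinuousLinearMap.snd ℝ ℝ (ℝ × ℝ))) p :=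
    hasFDerivAt_snd.fst.const_mul δ₁
  refine ContinuousLinearMap.ext fun ⟨a, b, c⟩ => ?_
  rw [hlin.fderiv, fderiv_base_apply, h.dirDeriv_et_X hp, h.dirDeriv_eu_X hp, hδ p hp]
  simp [mul_comm]

-- The determining equation `a² X_x² = a'(T)² T_t` with constant `X_x = δ₁` is separable: primitives
-- `F` of `a²` and `G` of `a'²` satisfy `G(T) = δ₁² F(t) + const`, which determines `T` from `t`.
theorem T_eq_of_fst_eq (h : MapsEquation Φ E E') (hc : IsPreconnected Φ.source) {p q : Base}
    (hp : p ∈ Φ.source) (hq : q ∈ Φ.source) (hpq : p.1 = q.1) : Φ.T p = Φ.T q := by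
  have hS := Φ.isOpen_source
  obtain ⟨δ₁, hδ⟩ := h.exists_dirDeriv_ex_X_eq hc
  obtain ⟨F, hF⟩ := exists_antiderivative E.isOpen_timeDomain E.isConnected_timeDomain
    (E.smooth_a.continuousOn.pow 2)
  obtain ⟨G, hG⟩ := exists_antiderivative E'.isOpen_timeDomain E'.isConnected_timeDomain
    (E'.smooth_a.continuousOn.pow 2)
  have hGT : ∀ r ∈ Φ.source,
      HasFDerivAt (fun r => G (Φ.T r)) (E'.a (Φ.T r) ^ 2 • fderiv ℝ Φ.T r) r :=
    fun r hr => (hG _ (h.1 _ hr).2).comp_hasFDerivAt r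
      (differentiableAt_of_contDiffOn hS Φ.contDiffOn_T hr).hasFDerivAt
  have hFt : ∀ r ∈ Φ.source, HasFDerivAt (fun r : Base => δ₁ ^ 2 * F r.1)
      (δ₁ ^ 2 • E.a r.1 ^ 2 • ContinuousLinearMap.fst ℝ ℝ (ℝ × ℝ)) r :=
    fun r hr => ((hF _ (h.1 _ hr).1).comp_hasFDerivAt r hasFDerivAt_fst).const_mul _
  obtain ⟨k, hk⟩ := hS.exists_eq_add_of_fderiv_eq hc
    (fun r hr => (hGT r hr).differentiableAt.differentiableWithinAt)
    (fun r hr => (hFt r hr).differentiableAt.differentiableWithinAt) fun r hr => by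
      rw [(hGT r hr).fderiv, (hFt r hr).fderiv]
      refine ContinuousLinearMap.ext fun ⟨a, b, c⟩ => ?_
      have hsq := h.sq_dirDeriv_ex_X_eq hr
      have hT := h.isTimeFibred r hr
      rw [hδ r hr] at hsq
      simp only [smul_apply, fderiv_base_apply, hT.1, hT.2, ContinuousLinearMap.coe_fst',
        smul_eq_mul, mul_zero, add_zero]
      linear_combination -a * hsq
  refine injOn_of_hasDerivAt_pos E'.isConnected_timeDomain.isPreconnected hG
    (fun t ht => sq_pos_of_ne_zero (E'.a_ne_zero t ht)) (h.1 p hp).2 (h.1 q hq).2 ?_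
  calc G (Φ.T p) = δ₁ ^ 2 * F p.1 + k := hk hp
    _ = δ₁ ^ 2 * F q.1 + k := by rw [hpq]
    _ = G (Φ.T q) := (hk hq).symm

theorem dirDeriv_eu_U_eq_of_fst_eq (h : MapsEquation Φ E E') (hc : IsPreconnected Φ.source)
    {θ : ℝ → ℝ} (hTt : ∀ p ∈ Φ.source, ∂ₜ Φ.T p = deriv θ p.1) {p q : Base} (hp : p ∈ Φ.source)
    (hq : q ∈ Φ.source) (hpq : p.1 = q.1) : ∂ᵤ Φ.U p = ∂ᵤ Φ.U q := by
  refine eq_of_sq_eq_sq_of_isPreconnected hc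
    (contDiffOn_dirDeriv Φ.isOpen_source Φ.contDiffOn_U eu).continuousOn
    (fun r hr => h.dirDeriv_eu_U_ne_zero hr) hp hq ?_
  have hc' := (h.U_eq_and_c_eq hp).2
  rw [hTt p hp, hpq, h.T_eq_of_fst_eq hc hp hq hpq, ← hTt q hq, (h.U_eq_and_c_eq hq).2] at hc'
  exact (mul_left_cancel₀ (mul_ne_zero (h.isTimeFibred.dirDeriv_et_T_ne_zero hq)
    (E'.c_ne_zero _ (h.1 _ hq).2)) hc').symm

theorem exists_hasForm (h : MapsEquation Φ E E') (hc : IsConnected Φ.source) :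
    ∃ (θ φ : ℝ → ℝ) (δ₁ δ₂ : ℝ), IsParameters (Prod.fst '' Φ.source) θ φ δ₁ ∧
      HasForm Φ θ φ δ₁ δ₂ := by
  have hS := Φ.isOpen_source
  obtain ⟨p₀, hp₀⟩ := hc.nonempty
  obtain ⟨δ₁, hδ⟩ := h.exists_dirDeriv_ex_X_eq hc.isPreconnected
  obtain ⟨δ₂, hX⟩ := h.exists_X_eq hc.isPreconnected hδ
  obtain ⟨θ, hθ, hT⟩ := exists_contDiffOn_comp_fst_eq hS Φ.contDiffOn_T
    fun p hp q hq => h.T_eq_of_fst_eq hc.isPreconnected hp hq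
  have hTt : ∀ p ∈ Φ.source, ∂ₜ Φ.T p = deriv θ p.1 := fun p hp => by
    rw [dirDeriv, (eventuallyEq_of_mem (hS.mem_nhds hp) hT).fderiv_eq]
    exact (dirDeriv_comp_fst (differentiableAt_of_contDiffOn_image_fst hS hθ hp) et).trans
      (one_mul _)
  obtain ⟨φ, hφ, hUu⟩ := exists_contDiffOn_comp_fst_eq hS (contDiffOn_dirDeriv hS Φ.contDiffOn_U eu)
    fun p hp q hq => h.dirDeriv_eu_U_eq_of_fst_eq hc.isPreconnected hTt hp hq
  refine ⟨θ, φ, δ₁, δ₂, ⟨hδ p₀ hp₀ ▸ h.dirDeriv_ex_X_ne_zero hp₀, hθ, hφ, ?_⟩, fun t x u hp => ?_⟩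
  · rintro _ ⟨p, hp, rfl⟩
    rw [← hTt p hp, ← hUu p hp]
    exact mul_ne_zero (h.isTimeFibred.dirDeriv_et_T_ne_zero hp) (h.dirDeriv_eu_U_ne_zero hp)
  · have hU : Φ.U (t, x, u) = φ t * u := by
      rw [(h.U_eq_and_c_eq hp).1, hUu _ hp, mul_comm]
    exact Prod.ext (hT _ hp) (Prod.ext (hX _ hp) hU)

end MapsEquation

/-! ### Transformations of the given form -/

/-- The transformation `(t, x, u) ↦ (θ(t), δ₁ x + δ₂, φ(t) u)`, on the whole space; a point
transformation satisfies `HasForm` if it coincides with this map on its domain. -/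
def formMap (θ φ : ℝ → ℝ) (δ₁ δ₂ : ℝ) (p : Base) : Base := (θ p.1, δ₁ * p.2.1 + δ₂, φ p.1 * p.2.2)

theorem fderiv_formMap_apply {θ φ : ℝ → ℝ} {δ₁ δ₂ : ℝ} {p : Base} (hθ : DifferentiableAt ℝ θ p.1)
    (hφ : DifferentiableAt ℝ φ p.1) (v : Base) : fderiv ℝ (formMap θ φ δ₁ δ₂) p v =
      (v.1 * deriv θ p.1, δ₁ * v.2.1, v.1 * deriv φ p.1 * p.2.2 + φ p.1 * v.2.2) := by
  have hxu : HasFDerivAt (𝕜 := ℝ) (fun q : Base => q.2) _ p := hasFDerivAt_snd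
  have hx : HasFDerivAt (fun q : Base => q.2.1) _ p := hxu.fst
  have hu : HasFDerivAt (fun q : Base => q.2.2) _ p := hxu.snd
  have hT : HasFDerivAt (fun q : Base => θ q.1) _ p :=
    hθ.hasDerivAt.hasFDerivAt.comp p hasFDerivAt_fst
  have hφ' : HasFDerivAt (fun q : Base => φ q.1) _ p :=
    hφ.hasDerivAt.hasFDerivAt.comp p hasFDerivAt_fst
  have hmap : HasFDerivAt (formMap θ φ δ₁ δ₂) _ p :=
    hT.prodMk (((hx.const_mul δ₁).add_const δ₂).prodMk (hφ'.fun_mul hu))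
  rw [hmap.fderiv]
  exact Prod.ext (by simp [mul_comm]) (Prod.ext (by simp) (by simp; ring))

namespace IsParameters

variable {J : Set ℝ} {θ φ : ℝ → ℝ} {δ₁ t : ℝ}

theorem deriv_ne_zero (h : IsParameters J θ φ δ₁) (ht : t ∈ J) : deriv θ t ≠ 0 :=
  left_ne_zero_of_mul (h.ne_zero t ht)

theorem phi_ne_zero (h : IsParameters J θ φ δ₁) (ht : t ∈ J) : φ t ≠ 0 :=
  right_ne_zero_of_mul (h.ne_zero t ht)

theorem elementFormulas_iff (h : IsParameters J θ φ δ₁) (ht : t ∈ J) {q q' : ℝ × ℝ × ℝ} :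
    ElementFormulas θ φ δ₁ t q q' ↔ δ₁ ^ 2 * q.1 ^ 2 = deriv θ t * q'.1 ^ 2 ∧
      φ t * q.2.1 + deriv φ t = φ t * deriv θ t * q'.2.1 ∧
      q.2.2 = φ t ^ 2 * deriv θ t * q'.2.2 := by
  have hθ := h.deriv_ne_zero ht
  have hφ := h.phi_ne_zero ht
  refine and_congr ?_ (and_congr ?_ ?_) <;> field_simp <;> exact eq_comm

end IsParameters

namespace HasForm

variable {E E' : Equation} {Φ : PointTransformation Base} {θ φ : ℝ → ℝ} {δ₁ δ₂ : ℝ} {p : Base}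

theorem T_eq (h : HasForm Φ θ φ δ₁ δ₂) (hp : p ∈ Φ.source) : Φ.T p = θ p.1 :=
  congrArg Prod.fst (h p.1 p.2.1 p.2.2 hp)

theorem U_eq (h : HasForm Φ θ φ δ₁ δ₂) (hp : p ∈ Φ.source) : Φ.U p = φ p.1 * p.2.2 :=
  congrArg (fun q : Base => q.2.2) (h p.1 p.2.1 p.2.2 hp)

theorem dirDeriv_eq (h : HasForm Φ θ φ δ₁ δ₂) (hpar : IsParameters (Prod.fst '' Φ.source) θ φ δ₁)
    (hp : p ∈ Φ.source) (v : Base) : (dirDeriv v Φ.T p, dirDeriv v Φ.X p, dirDeriv v Φ.U p) =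
      (v.1 * deriv θ p.1, δ₁ * v.2.1, v.1 * deriv φ p.1 * p.2.2 + φ p.1 * v.2.2) := by
  have hS := Φ.isOpen_source
  have hmap : Φ.toFun =ᶠ[𝓝 p] formMap θ φ δ₁ δ₂ :=
    eventuallyEq_of_mem (hS.mem_nhds hp) fun q hq => h q.1 q.2.1 q.2.2 hq
  have hθ := differentiableAt_of_contDiffOn_image_fst hS hpar.smooth_theta hp
  have hφ := differentiableAt_of_contDiffOn_image_fst hS hpar.smooth_phi hp
  exact (Φ.fderiv_toFun_apply hp v).symm.trans
    (hmap.fderiv_eq (𝕜 := ℝ) ▸ fderiv_formMap_apply hθ hφ v)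

theorem dirDeriv_T (h : HasForm Φ θ φ δ₁ δ₂) (hpar : IsParameters (Prod.fst '' Φ.source) θ φ δ₁)
    (hp : p ∈ Φ.source) (v : Base) : dirDeriv v Φ.T p = v.1 * deriv θ p.1 :=
  congrArg Prod.fst (h.dirDeriv_eq hpar hp v)

theorem dirDeriv_X (h : HasForm Φ θ φ δ₁ δ₂) (hpar : IsParameters (Prod.fst '' Φ.source) θ φ δ₁)
    (hp : p ∈ Φ.source) (v : Base) : dirDeriv v Φ.X p = δ₁ * v.2.1 :=
  congrArg (fun q : Base => q.2.1) (h.dirDeriv_eq hpar hp v)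

theorem dirDeriv_U (h : HasForm Φ θ φ δ₁ δ₂) (hpar : IsParameters (Prod.fst '' Φ.source) θ φ δ₁)
    (hp : p ∈ Φ.source) (v : Base) :
    dirDeriv v Φ.U p = v.1 * deriv φ p.1 * p.2.2 + φ p.1 * v.2.2 :=
  congrArg (fun q : Base => q.2.2) (h.dirDeriv_eq hpar hp v)

theorem isTimeFibred (h : HasForm Φ θ φ δ₁ δ₂)
    (hpar : IsParameters (Prod.fst '' Φ.source) θ φ δ₁) : Φ.IsTimeFibred := fun p hp => by
  simp [h.dirDeriv_T hpar hp, ex, eu]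

theorem totalDx0_X (h : HasForm Φ θ φ δ₁ δ₂) (hpar : IsParameters (Prod.fst '' Φ.source) θ φ δ₁)
    {j : Jet1} (hj : j.base ∈ Φ.source) : totalDx0 Φ.X j = δ₁ := by
  simp [totalDx0_eq, h.dirDeriv_X hpar hj, ex, eu]

theorem totalDx1_totalDx0_X (h : HasForm Φ θ φ δ₁ δ₂)
    (hpar : IsParameters (Prod.fst '' Φ.source) θ φ δ₁) {j : Jet2}
    (hj : j.toJet1.base ∈ Φ.source) : totalDx1 (totalDx0 Φ.X) j = 0 := by
  have hS := Φ.isOpen_source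
  have hX (v w : Base) : dirDeriv v (dirDeriv w Φ.X) j.toJet1.base = 0 :=
    dirDeriv_eq_zero_of_const_on hS (fun q hq => h.dirDeriv_X hpar hq w) hj
  simp [totalDx1_totalDx0 hS Φ.contDiffOn_X hj, hX, h.dirDeriv_X hpar hj, eu]

theorem totalDx1_totalDx0_U (h : HasForm Φ θ φ δ₁ δ₂)
    (hpar : IsParameters (Prod.fst '' Φ.source) θ φ δ₁) {j : Jet2}
    (hj : j.toJet1.base ∈ Φ.source) : totalDx1 (totalDx0 Φ.U) j = φ j.t * j.uxx := by
  have hS := Φ.isOpen_source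
  have hU := Φ.contDiffOn_U
  have hUx : ∀ q ∈ Φ.source, ∂ₓ Φ.U q = 0 := fun q hq => by simp [h.dirDeriv_U hpar hq, ex]
  have hUu : ∂ᵤ Φ.U =ᶠ[𝓝 j.toJet1.base] fun q => φ q.1 :=
    eventuallyEq_of_mem (hS.mem_nhds hj) fun q hq => by simp [h.dirDeriv_U hpar hq, eu]
  have hUuu : ∂ᵤ (∂ᵤ Φ.U) j.toJet1.base = 0 := by
    rw [dirDeriv, hUu.fderiv_eq]
    exact (dirDeriv_comp_fst (differentiableAt_of_contDiffOn_image_fst hS hpar.smooth_phi hj)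
      eu).trans (zero_mul _)
  rw [totalDx1_totalDx0 hS hU hj, dirDeriv_eq_zero_of_const_on hS hUx hj,
    dirDeriv_dirDeriv_eq_zero hS hU hUx hj, hUuu, hUu.eq_of_nhds]
  simp [Jet1.base, Jet2.toJet1, mul_comm]

theorem newUt_eq (h : HasForm Φ θ φ δ₁ δ₂) (hpar : IsParameters (Prod.fst '' Φ.source) θ φ δ₁)
    {j : Jet1} (hj : j.base ∈ Φ.source) :
    Φ.newUt j = (deriv φ j.1 * j.2.2.1 + φ j.1 * j.2.2.2.1) / deriv θ j.1 := by
  have hX : totalDt0 Φ.X j = 0 := by simp [totalDt0_eq, h.dirDeriv_X hpar hj, et, eu]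
  have hU : totalDt0 Φ.U j = deriv φ j.1 * j.2.2.1 + φ j.1 * j.2.2.2.1 := by
    rw [totalDt0_eq, h.dirDeriv_U hpar hj, h.dirDeriv_U hpar hj]
    simp [et, eu, Jet1.base, utL, mul_comm]
  have hT : ∂ₜ Φ.T j.base = deriv θ j.1 := (h.dirDeriv_T hpar hj et).trans (one_mul _)
  rw [(h.isTimeFibred hpar).newUt_eq hj, h.totalDx0_X hpar hj, hX, hU, hT, zero_mul, sub_zero,
    mul_comm (deriv θ j.1), mul_div_mul_left _ _ hpar.delta_ne_zero]

theorem newDx_newUx_eq (h : HasForm Φ θ φ δ₁ δ₂)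
    (hpar : IsParameters (Prod.fst '' Φ.source) θ φ δ₁) {j : Jet2}
    (hj : j.toJet1.base ∈ Φ.source) : Φ.newDx Φ.newUx j = φ j.t * j.uxx / δ₁ ^ 2 := by
  have hX := h.totalDx0_X hpar hj
  have hδ := hpar.delta_ne_zero
  rw [(h.isTimeFibred hpar).newDx_newUx_eq hj (hX ▸ hδ), h.totalDx1_totalDx0_U hpar hj,
    h.totalDx1_totalDx0_X hpar hj, hX]
  field_simp
  ring

theorem totalJacobian_ne_zero (h : HasForm Φ θ φ δ₁ δ₂)
    (hpar : IsParameters (Prod.fst '' Φ.source) θ φ δ₁) {j : Jet1} (hj : j.base ∈ Φ.source) :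
    Φ.totalJacobian j ≠ 0 := by
  have hT := h.isTimeFibred hpar
  rw [hT.totalJacobian_eq hj, h.totalDx0_X hpar hj]
  exact mul_ne_zero (hT.dirDeriv_et_T_ne_zero hj) hpar.delta_ne_zero

theorem prolong_mem_manifold_iff (h : HasForm Φ θ φ δ₁ δ₂)
    (hpar : IsParameters (Prod.fst '' Φ.source) θ φ δ₁) {j : Jet2}
    (hj : j.toJet1.base ∈ Φ.source) :
    Φ.prolong j ∈ E'.manifold ↔ θ j.t ∈ E'.timeDomain ∧
      δ₁ ^ 2 * (deriv φ j.t * j.u + φ j.t * j.ut) = deriv θ j.t * φ j.t *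
        (E'.a (θ j.t) ^ 2 * j.uxx +
          δ₁ ^ 2 * (E'.b (θ j.t) * j.u - E'.c (θ j.t) * φ j.t ^ 2 * j.u ^ 3)) := by
  have hθ : deriv θ j.t ≠ 0 := hpar.deriv_ne_zero (mem_image_of_mem _ hj)
  have hδ := hpar.delta_ne_zero
  change Φ.T j.toJet1.base ∈ E'.timeDomain ∧ Φ.newUt j.toJet1 =
    E'.a (Φ.T j.toJet1.base) ^ 2 * Φ.newDx Φ.newUx j +
      E'.b (Φ.T j.toJet1.base) * Φ.U j.toJet1.base -
        E'.c (Φ.T j.toJet1.base) * Φ.U j.toJet1.base ^ 3 ↔ _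
  rw [h.T_eq hj, h.U_eq hj, h.newUt_eq hpar hj, h.newDx_newUx_eq hpar hj]
  simp only [Jet2.toJet1, Jet1.base]
  refine and_congr_right fun _ => ?_
  field_simp
  constructor <;> intro heq <;> linear_combination heq

theorem mapsEquation_of_elementFormulas (h : HasForm Φ θ φ δ₁ δ₂)
    (hpar : IsParameters (Prod.fst '' Φ.source) θ φ δ₁) (hfit : Fits Φ E E')
    (hel : ∀ t ∈ Prod.fst '' Φ.source, ElementFormulas θ φ δ₁ t (E.a t, E.b t, E.c t)
      (E'.a (θ t), E'.b (θ t), E'.c (θ t))) : MapsEquation Φ E E' := by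
  refine ⟨hfit, fun j hj _ => ?_⟩
  have ht : j.t ∈ Prod.fst '' Φ.source := mem_image_of_mem _ hj
  have hE' : θ j.t ∈ E'.timeDomain := h.T_eq hj ▸ (hfit _ hj).2
  obtain ⟨ha, hb, hc⟩ := (hpar.elementFormulas_iff ht).1 (hel _ ht)
  simp only at ha hb hc
  rw [h.prolong_mem_manifold_iff hpar hj, and_iff_right hE']
  change j.t ∈ E.timeDomain ∧ _ ↔ _
  rw [and_iff_right (show j.t ∈ E.timeDomain from (hfit _ hj).1)]
  have hfactor : δ₁ ^ 2 * φ j.t ≠ 0 :=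
    mul_ne_zero (pow_ne_zero 2 hpar.delta_ne_zero) (hpar.phi_ne_zero ht)
  rw [← mul_right_inj' hfactor]
  constructor <;> intro heq
  · linear_combination heq + φ j.t * j.uxx * ha + δ₁ ^ 2 * j.u * hb - δ₁ ^ 2 * φ j.t * j.u ^ 3 * hc
  · linear_combination heq - φ j.t * j.uxx * ha - δ₁ ^ 2 * j.u * hb + δ₁ ^ 2 * φ j.t * j.u ^ 3 * hc

theorem elementFormulas_of_mapsEquation (h : HasForm Φ θ φ δ₁ δ₂)
    (hpar : IsParameters (Prod.fst '' Φ.source) θ φ δ₁) (hm : MapsEquation Φ E E')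
    (hp : p ∈ Φ.source) : ElementFormulas θ φ δ₁ p.1 (E.a p.1, E.b p.1, E.c p.1)
      (E'.a (θ p.1), E'.b (θ p.1), E'.c (θ p.1)) := by
  obtain ⟨t, x, u⟩ := p
  have ht : t ∈ Prod.fst '' Φ.source := mem_image_of_mem Prod.fst hp
  have hφ := hpar.phi_ne_zero ht
  have hδ := pow_ne_zero 2 hpar.delta_ne_zero
  have heq {s : ℝ} (hs : (t, x, s) ∈ Φ.source) (uxx : ℝ) :
      δ₁ ^ 2 * (deriv φ t * s + φ t * (E.a t ^ 2 * uxx + E.b t * s - E.c t * s ^ 3)) =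
        deriv θ t * φ t * (E'.a (θ t) ^ 2 * uxx +
          δ₁ ^ 2 * (E'.b (θ t) * s - E'.c (θ t) * φ t ^ 2 * s ^ 3)) :=
    ((h.prolong_mem_manifold_iff hpar (j := E.jet (t, x, s) 0 uxx) hs).1
      ((hm.2 (E.jet (t, x, s) 0 uxx) hs (h.totalJacobian_ne_zero hpar hs)).1
        ⟨(hm.1 _ hs).1, rfl⟩)).2
  have hline : ∀ᶠ s in 𝓝 u, (t, x, s) ∈ Φ.source :=
    (by fun_prop : Continuous fun s : ℝ => (t, x, s)).continuousAt.eventually_mem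
      (Φ.isOpen_source.mem_nhds hp)
  have hcubic := cubic_eq_zero_of_eventually_eval_eq_zero (a := u)
    (P := ⟨φ t * (φ t ^ 2 * deriv θ t * E'.c (θ t) - E.c t), 0,
      φ t * E.b t + deriv φ t - φ t * deriv θ t * E'.b (θ t), 0⟩) <| by
    filter_upwards [hline] with s hs
    simp only [Cubic.toPoly, Polynomial.eval_add, Polynomial.eval_mul, Polynomial.eval_C,
      Polynomial.eval_pow, Polynomial.eval_X]
    apply mul_left_cancel₀ hδ
    linear_combination heq hs 0
  obtain ⟨hc, -, hb, -⟩ := Cubic.ext_iff.1 hcubic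
  refine (hpar.elementFormulas_iff ht).2 ⟨?_, sub_eq_zero.1 hb, ?_⟩
  · apply mul_left_cancel₀ hφ
    linear_combination heq hp 1 - heq hp 0
  · exact (sub_eq_zero.1 ((mul_eq_zero.1 hc).resolve_left hφ)).symm

end HasForm

theorem mem_equivalenceGroupoid_iff {E E' : Equation} {Φ : PointTransformation Base} :
    (E, E', Φ) ∈ equivalenceGroupoid ↔
      IsConnected Φ.source ∧ Fits Φ E E' ∧ ∃ (θ φ : ℝ → ℝ) (δ₁ δ₂ : ℝ),
        IsParameters (Prod.fst '' Φ.source) θ φ δ₁ ∧ HasForm Φ θ φ δ₁ δ₂ ∧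
        ∀ t ∈ Prod.fst '' Φ.source,
          ElementFormulas θ φ δ₁ t (E.a t, E.b t, E.c t) (E'.a (θ t), E'.b (θ t), E'.c (θ t)) := by
  constructor
  · rintro ⟨hc, hm⟩
    obtain ⟨θ, φ, δ₁, δ₂, hpar, hf⟩ := hm.exists_hasForm hc
    refine ⟨hc, hm.1, θ, φ, δ₁, δ₂, hpar, hf, ?_⟩
    rintro _ ⟨p, hp, rfl⟩
    exact hf.elementFormulas_of_mapsEquation hpar hm hp
  · rintro ⟨hc, hfit, θ, φ, δ₁, δ₂, hpar, hf, hel⟩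
    exact ⟨hc, hf.mapsEquation_of_elementFormulas hpar hfit hel⟩

/-! ### Transformations of the extended space -/

theorem bijective_fderiv_prodMk {V W : Type*} [NormedAddCommGroup V] [NormedSpace ℝ V]
    [NormedAddCommGroup W] [NormedSpace ℝ W] {f : V → V} {g : V × W → W} {z : V × W}
    (hf : DifferentiableAt ℝ f z.1) (hg : DifferentiableAt ℝ g z)
    (hf' : Function.Bijective (fderiv ℝ f z.1))
    (hg' : Function.Bijective (fderiv ℝ (fun q => g (z.1, q)) z.2)) :
    Function.Bijective (fderiv ℝ (fun y : V × W => (f y.1, g y)) z) := by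
  have hfst : HasFDerivAt (fun y : V × W => f y.1) _ z := hf.hasFDerivAt.comp z hasFDerivAt_fst
  have hL (v : V) (w : W) : fderiv ℝ (fun y : V × W => (f y.1, g y)) z (v, w) =
      (fderiv ℝ f z.1 v, fderiv ℝ g z (v, 0) + fderiv ℝ (fun q => g (z.1, q)) z.2 w) := by
    have hslice : HasFDerivAt (fun q => g (z.1, q)) _ z.2 :=
      hg.hasFDerivAt.comp z.2 (hasFDerivAt_prodMk_right z.1 z.2)
    rw [(hfst.prodMk hg.hasFDerivAt).fderiv, hslice.fderiv]
    simp [← map_add]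
  constructor
  · refine (injective_iff_map_eq_zero _).2 fun ⟨v, w⟩ h0 => ?_
    rw [hL, Prod.mk_eq_zero] at h0
    obtain rfl : v = 0 := hf'.injective (h0.1.trans (map_zero _).symm)
    have hw : fderiv ℝ (fun q => g (z.1, q)) z.2 w = 0 := by simpa [← Prod.zero_eq_mk] using h0.2
    rw [hg'.injective (hw.trans (map_zero _).symm), Prod.mk_zero_zero]
  · rintro ⟨v', w'⟩
    obtain ⟨v, rfl⟩ := hf'.surjective v'
    obtain ⟨w, hw⟩ := hg'.surjective (w' - fderiv ℝ g z (v, 0))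
    exact ⟨(v, w), by rw [hL, hw, add_sub_cancel]⟩

theorem bijective_of_forall_eq_zero {V : Type*} [NormedAddCommGroup V] [NormedSpace ℝ V]
    [FiniteDimensional ℝ V] (L : V →L[ℝ] V) (h : ∀ v, L v = 0 → v = 0) : Function.Bijective L := by
  have hinj : Function.Injective (L : V →ₗ[ℝ] V) := (injective_iff_map_eq_zero _).2 h
  exact ⟨hinj, LinearMap.injective_iff_surjective.1 hinj⟩

theorem isOpen_image_and_exists_leftInverse {J : Set ℝ} {θ : ℝ → ℝ} (hJ : IsOpen J)
    (hθ : ContDiffOn ℝ ∞ θ J) (h0 : ∀ t ∈ J, deriv θ t ≠ 0) (hinj : InjOn θ J) :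
    IsOpen (θ '' J) ∧ ∃ η : ℝ → ℝ, ContDiffOn ℝ ∞ η (θ '' J) ∧ ∀ t ∈ J, η (θ t) = t := by
  have hsmooth : ∀ t ∈ J, ContDiffAt ℝ ∞ θ t := fun t ht => hθ.contDiffAt (hJ.mem_nhds ht)
  have hopen : IsOpenMap (J.domRestrict θ) := isOpenMap_iff_nhds_le.2 fun t => by
    have hstrict := (hsmooth t t.2).hasStrictDerivAt (by simp)
    change 𝓝 (θ t) ≤ map (θ ∘ (↑)) (𝓝 t)
    rw [← map_map, map_nhds_subtype_val, hJ.nhdsWithin_eq t.2, hstrict.map_nhds_eq (h0 t t.2)]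
  let e : OpenPartialHomeomorph ℝ ℝ := .ofContinuousOpenRestrict
    (hinj.bijOn_image.toPartialEquiv θ J (θ '' J)) hθ.continuousOn hopen hJ
  refine ⟨e.open_target, e.symm, ?_, fun t ht => e.left_inv ht⟩
  rintro _ ⟨t, ht, rfl⟩
  have hinv : e.symm (θ t) = t := e.left_inv ht
  have hd : HasDerivAt e (deriv θ t) (e.symm (θ t)) := by
    rw [hinv]
    exact ((hsmooth t ht).differentiableAt (by simp)).hasDerivAt
  have hcd : ContDiffAt ℝ ∞ e (e.symm (θ t)) := by
    rw [hinv]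
    exact hsmooth t ht
  exact (e.contDiffAt_symm_deriv (h0 t ht) (mem_image_of_mem θ ht) hd hcd).contDiffWithinAt

theorem isOpen_elementValues : IsOpen elementValues :=
  (isOpen_ne_fun continuous_fst continuous_const).inter
    (isOpen_ne_fun continuous_snd.snd continuous_const)

/-- The action on the values `(α, β, γ)` of the arbitrary elements at the time `t`, with the factor
`κ(t)` of `α`. It satisfies `ElementFormulas` if `κ² = δ₁² / θ_t`: these determine `κ` only up to
its sign, hence the choice. -/
def elementMap (θ φ κ : ℝ → ℝ) (t : ℝ) (q : ℝ × ℝ × ℝ) : ℝ × ℝ × ℝ :=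
  (κ t * q.1, 1 / (φ t * deriv θ t) * (φ t * q.2.1 + deriv φ t),
    1 / (φ t ^ 2 * deriv θ t) * q.2.2)

namespace IsParameters

variable {J : Set ℝ} {θ φ κ : ℝ → ℝ} {δ₁ t : ℝ}

theorem injOn_theta (h : IsParameters J θ φ δ₁) (hJ : IsOpen J) (hc : IsPreconnected J)
    (hpos : ∀ t ∈ J, 0 < deriv θ t) : InjOn θ J :=
  injOn_of_hasDerivAt_pos hc
    (fun _ ht => (differentiableAt_of_contDiffOn hJ h.smooth_theta ht).hasDerivAt) hpos

theorem mem_elementValues (h : IsParameters J θ φ δ₁) (ht : t ∈ J) {q q' : ℝ × ℝ × ℝ}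
    (hq : q ∈ elementValues) (hel : ElementFormulas θ φ δ₁ t q q') : q' ∈ elementValues := by
  obtain ⟨ha, -, hc⟩ := (h.elementFormulas_iff ht).1 hel
  refine ⟨fun h0 => ?_, right_ne_zero_of_mul (hc ▸ hq.2)⟩
  rw [h0, zero_pow two_ne_zero, mul_zero] at ha
  exact mul_ne_zero (pow_ne_zero 2 h.delta_ne_zero) (pow_ne_zero 2 hq.1) ha

theorem contDiffOn_elementMap (h : IsParameters J θ φ δ₁) (hJ : IsOpen J)
    (hκ : ContDiffOn ℝ ∞ κ J) :
    ContDiffOn ℝ ∞ (fun z : ℝ × ℝ × ℝ × ℝ => elementMap θ φ κ z.1 z.2) (J ×ˢ univ) := by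
  have hcomp {f : ℝ → ℝ} (hf : ContDiffOn ℝ ∞ f J) :
      ContDiffOn ℝ ∞ (fun z : ℝ × ℝ × ℝ × ℝ => f z.1) (J ×ˢ univ) :=
    hf.comp contDiffOn_fst fun z hz => hz.1
  have hθ' := hcomp (h.smooth_theta.deriv_of_isOpen hJ le_rfl)
  have hφ' := hcomp (h.smooth_phi.deriv_of_isOpen hJ le_rfl)
  have hφ := hcomp h.smooth_phi
  refine ((hcomp hκ).mul (by fun_prop)).prodMk (ContDiffOn.prodMk ?_ ?_)
  · exact (contDiffOn_const.div (hφ.mul hθ') fun z hz =>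
      mul_ne_zero (h.phi_ne_zero hz.1) (h.deriv_ne_zero hz.1)).mul
        ((hφ.mul (by fun_prop)).add hφ')
  · exact (contDiffOn_const.div ((hφ.pow 2).mul hθ') fun z hz =>
      mul_ne_zero (pow_ne_zero 2 (h.phi_ne_zero hz.1)) (h.deriv_ne_zero hz.1)).mul (by fun_prop)

theorem injective_elementMap (h : IsParameters J θ φ δ₁) (ht : t ∈ J) (hκ : κ t ≠ 0) :
    Function.Injective (elementMap θ φ κ t) := by
  have hφ := h.phi_ne_zero ht
  have hθ := h.deriv_ne_zero ht
  rintro ⟨α, β, γ⟩ ⟨α', β', γ'⟩ heq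
  simpa [elementMap, hκ, hφ, hθ] using heq

theorem bijective_fderiv_elementMap (h : IsParameters J θ φ δ₁) (ht : t ∈ J) (hκ : κ t ≠ 0)
    (q : ℝ × ℝ × ℝ) : Function.Bijective (fderiv ℝ (elementMap θ φ κ t) q) := by
  have hφ := h.phi_ne_zero ht
  have hθ := h.deriv_ne_zero ht
  have hα : HasFDerivAt (𝕜 := ℝ) (fun r : ℝ × ℝ × ℝ => r.1) _ q := hasFDerivAt_fst
  have hβγ : HasFDerivAt (𝕜 := ℝ) (fun r : ℝ × ℝ × ℝ => r.2) _ q := hasFDerivAt_snd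
  have hmap : HasFDerivAt (elementMap θ φ κ t) _ q :=
    (hα.const_mul _).prodMk ((((hβγ.fst.const_mul _).add_const _).const_mul _).prodMk
      (hβγ.snd.const_mul _))
  refine bijective_of_forall_eq_zero _ fun ⟨α, β, γ⟩ h0 => ?_
  rw [hmap.fderiv] at h0
  simpa [hκ, hφ, hθ] using h0

end IsParameters

theorem elementFormulas_elementMap {θ φ κ : ℝ → ℝ} {δ₁ t : ℝ}
    (hκ : κ t ^ 2 = δ₁ ^ 2 / deriv θ t) (q : ℝ × ℝ × ℝ) :
    ElementFormulas θ φ δ₁ t q (elementMap θ φ κ t q) :=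
  ⟨by rw [elementMap, mul_pow, hκ], rfl, rfl⟩

theorem exists_extendedTransformation (Φ : PointTransformation Base) {θ φ κ : ℝ → ℝ} {δ₁ : ℝ}
    (hpar : IsParameters (Prod.fst '' Φ.source) θ φ δ₁)
    (hκ : ContDiffOn ℝ ∞ κ (Prod.fst '' Φ.source)) (h0 : ∀ t ∈ Prod.fst '' Φ.source, κ t ≠ 0) :
    ∃ Ψ : ExtendedTransformation, Ψ.base = Φ ∧
      Ψ.total.toFun = fun z => (Φ.toFun z.1, elementMap θ φ κ z.1.1 z.2) := by
  have hJ := isOpenMap_fst _ Φ.isOpen_source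
  have hopen : IsOpen (Φ.source ×ˢ elementValues) := Φ.isOpen_source.prod isOpen_elementValues
  have helement : ContDiffOn ℝ ∞ (fun z : Base × (ℝ × ℝ × ℝ) => elementMap θ φ κ z.1.1 z.2)
      (Φ.source ×ˢ elementValues) :=
    (hpar.contDiffOn_elementMap hJ hκ).comp (g := fun z : ℝ × ℝ × ℝ × ℝ => elementMap θ φ κ z.1 z.2)
      (f := fun z : Base × (ℝ × ℝ × ℝ) => (z.1.1, z.2)) (by fun_prop)
      fun z hz => ⟨mem_image_of_mem _ hz.1, mem_univ _⟩
  refine ⟨{ base := Φ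
            total :=
              { source := Φ.source ×ˢ elementValues
                toFun := fun z => (Φ.toFun z.1, elementMap θ φ κ z.1.1 z.2)
                isOpen_source := hopen
                smooth := (Φ.smooth.comp contDiffOn_fst fun z hz => hz.1).prodMk helement
                injOn := ?_
                nondegenerate := fun z hz => ?_ }
            source_total := rfl
            projectable := fun z _ => rfl }, rfl, rfl⟩
  · rintro ⟨p, q⟩ hz ⟨p', q'⟩ hz' heq
    obtain ⟨hbase, helements⟩ := Prod.mk.inj heq
    obtain rfl : p = p' := Φ.injOn hz.1 hz'.1 hbase
    have ht := mem_image_of_mem Prod.fst hz.1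
    exact congrArg (Prod.mk p) (hpar.injective_elementMap ht (h0 _ ht) helements)
  · have ht := mem_image_of_mem Prod.fst hz.1
    exact bijective_fderiv_prodMk (differentiableAt_of_contDiffOn Φ.isOpen_source Φ.smooth hz.1)
      (differentiableAt_of_contDiffOn hopen helement hz) (Φ.nondegenerate _ hz.1)
      (hpar.bijective_fderiv_elementMap ht (h0 _ ht) z.2)

theorem HasForm.exists_isGivenBy {Φ : PointTransformation Base} {θ φ κ : ℝ → ℝ} {δ₁ δ₂ : ℝ}
    (h : HasForm Φ θ φ δ₁ δ₂) (hpar : IsParameters (Prod.fst '' Φ.source) θ φ δ₁)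
    (hκ : ContDiffOn ℝ ∞ κ (Prod.fst '' Φ.source))
    (hsq : ∀ t ∈ Prod.fst '' Φ.source, κ t ^ 2 = δ₁ ^ 2 / deriv θ t) :
    ∃ Ψ : ExtendedTransformation, Ψ.base = Φ ∧ Ψ.IsGivenBy θ φ δ₁ δ₂ ∧
      ∀ p q, (Ψ.total.toFun (p, q)).2 = elementMap θ φ κ p.1 q := by
  have h0 : ∀ t ∈ Prod.fst '' Φ.source, κ t ≠ 0 := fun t ht => by
    have hne := div_ne_zero (pow_ne_zero 2 hpar.delta_ne_zero) (hpar.deriv_ne_zero ht)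
    rwa [← hsq t ht, pow_ne_zero_iff two_ne_zero] at hne
  obtain ⟨Ψ, rfl, hΨ⟩ := exists_extendedTransformation Φ hpar hκ h0
  refine ⟨Ψ, rfl, ⟨h, fun p hp q _ => ?_⟩, fun p q => by rw [hΨ]⟩
  rw [hΨ]
  exact elementFormulas_elementMap (hsq _ (mem_image_of_mem _ hp)) q

theorem exists_pointTransformation {Ω : Set Base} {θ φ : ℝ → ℝ} {δ₁ : ℝ} (hΩ : IsOpen Ω)
    (hpar : IsParameters (Prod.fst '' Ω) θ φ δ₁) (hinj : InjOn θ (Prod.fst '' Ω)) (δ₂ : ℝ) :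
    ∃ Φ : PointTransformation Base, Φ.source = Ω ∧ HasForm Φ θ φ δ₁ δ₂ := by
  have hmem : ∀ p ∈ Ω, p.1 ∈ Prod.fst '' Ω := fun p hp => mem_image_of_mem _ hp
  have hθ : ContDiffOn ℝ ∞ (fun p : Base => θ p.1) Ω := hpar.smooth_theta.comp contDiffOn_fst hmem
  have hφ : ContDiffOn ℝ ∞ (fun p : Base => φ p.1) Ω := hpar.smooth_phi.comp contDiffOn_fst hmem
  have hδ := hpar.delta_ne_zero
  refine ⟨{ source := Ω
            toFun := formMap θ φ δ₁ δ₂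
            isOpen_source := hΩ
            smooth := hθ.prodMk (ContDiffOn.prodMk (by fun_prop) (hφ.mul (by fun_prop)))
            injOn := ?_
            nondegenerate := fun p hp => ?_ }, rfl, fun t x u _ => rfl⟩
  · rintro ⟨t, x, u⟩ hp ⟨t', x', u'⟩ hp' heq
    obtain ⟨htheta, hxu⟩ := Prod.mk.inj heq
    obtain rfl : t = t' := hinj (hmem _ hp) (hmem _ hp') htheta
    simpa [hδ, hpar.phi_ne_zero (hmem _ hp)] using hxu
  · refine bijective_of_forall_eq_zero _ fun ⟨t, x, u⟩ h0 => ?_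
    rw [fderiv_formMap_apply
      (differentiableAt_of_contDiffOn_image_fst hΩ hpar.smooth_theta hp)
      (differentiableAt_of_contDiffOn_image_fst hΩ hpar.smooth_phi hp)] at h0
    obtain ⟨ht, hx, hu⟩ : t = 0 ∧ x = 0 ∧ t * deriv φ p.1 * p.2.2 + φ p.1 * u = 0 := by
      simpa [hpar.deriv_ne_zero (hmem _ hp), hδ] using h0
    subst ht hx
    simpa [hpar.phi_ne_zero (hmem _ hp)] using hu

/-! ### The equivalence group -/

theorem exists_equation_comp_eq {J : Set ℝ} {θ : ℝ → ℝ} {k : ℝ → ℝ × ℝ × ℝ} (hJ : IsOpen J)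
    (hc : IsConnected J) (hθ : ContDiffOn ℝ ∞ θ J) (h0 : ∀ t ∈ J, deriv θ t ≠ 0)
    (hinj : InjOn θ J) (hk : ContDiffOn ℝ ∞ k J) (hval : ∀ t ∈ J, k t ∈ elementValues) :
    ∃ E : Equation, E.timeDomain = θ '' J ∧ ∀ t ∈ J, (E.a (θ t), E.b (θ t), E.c (θ t)) = k t := by
  obtain ⟨hopen, η, hη, hηθ⟩ := isOpen_image_and_exists_leftInverse hJ hθ h0 hinj
  have hηJ : MapsTo η (θ '' J) J := by
    rintro _ ⟨t, ht, rfl⟩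
    rwa [hηθ t ht]
  have hkη : ContDiffOn ℝ ∞ (k ∘ η) (θ '' J) := hk.comp hη hηJ
  exact ⟨{ timeDomain := θ '' J
           isOpen_timeDomain := hopen
           isConnected_timeDomain := hc.image θ hθ.continuousOn
           a := fun s => (k (η s)).1
           b := fun s => (k (η s)).2.1
           c := fun s => (k (η s)).2.2
           smooth_a := hkη.fst
           smooth_b := hkη.snd.fst
           smooth_c := hkη.snd.snd
           a_ne_zero := fun s hs => (hval _ (hηJ hs)).1
           c_ne_zero := fun s hs => (hval _ (hηJ hs)).2 }, rfl, fun t ht => congrArg k (hηθ t ht)⟩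

/-- The equation of the class with the constant coefficients `q = (a, b, c)`. -/
def Equation.const (q : ℝ × ℝ × ℝ) (hq : q ∈ elementValues) : Equation where
  timeDomain := univ
  isOpen_timeDomain := isOpen_univ
  isConnected_timeDomain := isConnected_univ
  a := fun _ => q.1
  b := fun _ => q.2.1
  c := fun _ => q.2.2
  smooth_a := contDiffOn_const
  smooth_b := contDiffOn_const
  smooth_c := contDiffOn_const
  a_ne_zero := fun _ _ => hq.1
  c_ne_zero := fun _ _ => hq.2

theorem exists_isGivenBy_of_mem_equivalenceGroup {Ψ : ExtendedTransformation}
    (h : Ψ ∈ equivalenceGroup) : ∃ (θ φ : ℝ → ℝ) (δ₁ δ₂ : ℝ),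
      IsParameters (Prod.fst '' Ψ.base.source) θ φ δ₁ ∧ Ψ.IsGivenBy θ φ δ₁ δ₂ := by
  obtain ⟨hc, hmaps⟩ := h
  obtain ⟨_, -, hm⟩ := hmaps (.const (1, 0, 1) ⟨one_ne_zero, one_ne_zero⟩) fun _ _ => mem_univ _
  obtain ⟨θ, φ, δ₁, δ₂, hpar, hf⟩ := hm.exists_hasForm hc
  refine ⟨θ, φ, δ₁, δ₂, hpar, hf, fun p hp q hq => ?_⟩
  obtain ⟨E', htr, hm'⟩ := hmaps (.const q hq) fun _ _ => mem_univ _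
  have helements : (Ψ.total.toFun (p, q)).2 = _ := htr.2 p hp
  rw [helements, hf.T_eq hp]
  exact hf.elementFormulas_of_mapsEquation hpar hm' hp

namespace ExtendedTransformation.IsGivenBy

variable {Ψ : ExtendedTransformation} {E E' : Equation} {θ φ : ℝ → ℝ} {δ₁ δ₂ : ℝ}

theorem deriv_pos (h : Ψ.IsGivenBy θ φ δ₁ δ₂)
    (hpar : IsParameters (Prod.fst '' Ψ.base.source) θ φ δ₁) :
    ∀ t ∈ Prod.fst '' Ψ.base.source, 0 < deriv θ t := by
  rintro _ ⟨p, hp, rfl⟩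
  have ht := mem_image_of_mem Prod.fst hp
  have hone : ((1, 0, 1) : ℝ × ℝ × ℝ) ∈ elementValues := ⟨one_ne_zero, one_ne_zero⟩
  have hsq := ((hpar.elementFormulas_iff ht).1 (h.2 p hp _ hone)).1
  refine pos_of_mul_pos_left ?_ (sq_nonneg (Ψ.total.toFun (p, (1, 0, 1))).2.1)
  rw [← hsq]
  exact mul_pos (sq_pos_of_ne_zero hpar.delta_ne_zero) (by norm_num)

theorem mapsEquation (h : Ψ.IsGivenBy θ φ δ₁ δ₂)
    (hpar : IsParameters (Prod.fst '' Ψ.base.source) θ φ δ₁) (htr : Ψ.TransformsElements E E') :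
    MapsEquation Ψ.base E E' := by
  refine h.1.mapsEquation_of_elementFormulas hpar htr.1 ?_
  rintro _ ⟨p, hp, rfl⟩
  have ht := (htr.1 p hp).1
  have hel := h.2 p hp (E.a p.1, E.b p.1, E.c p.1) ⟨E.a_ne_zero _ ht, E.c_ne_zero _ ht⟩
  rwa [htr.2 p hp, h.1.T_eq hp] at hel

theorem exists_transformed_elements (h : Ψ.IsGivenBy θ φ δ₁ δ₂)
    (hpar : IsParameters (Prod.fst '' Ψ.base.source) θ φ δ₁) (hc : IsPreconnected Ψ.base.source)
    (hE : ∀ p ∈ Ψ.base.source, p.1 ∈ E.timeDomain) :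
    ∃ k : ℝ → ℝ × ℝ × ℝ, ContDiffOn ℝ ∞ k (Prod.fst '' Ψ.base.source) ∧
      ∀ p ∈ Ψ.base.source,
        k p.1 ∈ elementValues ∧ (Ψ.total.toFun (p, (E.a p.1, E.b p.1, E.c p.1))).2 = k p.1 := by
  let f : Base → ℝ × ℝ × ℝ := fun p => (Ψ.total.toFun (p, (E.a p.1, E.b p.1, E.c p.1))).2
  have hval : ∀ p ∈ Ψ.base.source, (E.a p.1, E.b p.1, E.c p.1) ∈ elementValues := fun p hp =>
    ⟨E.a_ne_zero _ (hE p hp), E.c_ne_zero _ (hE p hp)⟩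
  have hel : ∀ p ∈ Ψ.base.source, ElementFormulas θ φ δ₁ p.1 (E.a p.1, E.b p.1, E.c p.1) (f p) :=
    fun p hp => h.2 p hp _ (hval p hp)
  have hfval : ∀ p ∈ Ψ.base.source, f p ∈ elementValues := fun p hp =>
    hpar.mem_elementValues (mem_image_of_mem _ hp) (hval p hp) (hel p hp)
  have hf : ContDiffOn ℝ ∞ f Ψ.base.source := by
    refine (Ψ.total.smooth.comp (contDiffOn_id.prodMk
      ((E.smooth_a.comp contDiffOn_fst hE).prodMk ((E.smooth_b.comp contDiffOn_fst hE).prodMk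
        (E.smooth_c.comp contDiffOn_fst hE)))) fun p hp => ?_).snd
    rw [Ψ.source_total]
    exact ⟨hp, hval p hp⟩
  obtain ⟨k, hk, hfk⟩ := exists_contDiffOn_comp_fst_eq Ψ.base.isOpen_source hf <| by
    intro p hp q hq hpq
    obtain ⟨hap, hbp, hcp⟩ := hel p hp
    obtain ⟨haq, hbq, hcq⟩ := hpq ▸ hel q hq
    -- the formulas determine the transformed value of `a` only up to sign
    have ha : (f p).1 = (f q).1 := eq_of_sq_eq_sq_of_isPreconnected hc hf.continuousOn.fst
      (fun r hr => (hfval r hr).1) hp hq (hap.trans haq.symm)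
    exact Prod.ext ha (Prod.ext (hbp.trans hbq.symm) (hcp.trans hcq.symm))
  exact ⟨k, hk, fun p hp => ⟨hfk p hp ▸ hfval p hp, hfk p hp⟩⟩

theorem exists_transformsElements (h : Ψ.IsGivenBy θ φ δ₁ δ₂)
    (hpar : IsParameters (Prod.fst '' Ψ.base.source) θ φ δ₁) (hc : IsConnected Ψ.base.source)
    (hE : ∀ p ∈ Ψ.base.source, p.1 ∈ E.timeDomain) : ∃ E', Ψ.TransformsElements E E' := by
  have hJ := isOpenMap_fst _ Ψ.base.isOpen_source
  have hJc : IsConnected (Prod.fst '' Ψ.base.source) := hc.image _ continuous_fst.continuousOn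
  obtain ⟨k, hk, hkΨ⟩ := h.exists_transformed_elements hpar hc.isPreconnected hE
  obtain ⟨E', htime, hE'⟩ := exists_equation_comp_eq hJ hJc hpar.smooth_theta
    (fun t ht => hpar.deriv_ne_zero ht)
    (hpar.injOn_theta hJ hJc.isPreconnected (h.deriv_pos hpar)) hk
    (by rintro _ ⟨p, hp, rfl⟩; exact (hkΨ p hp).1)
  refine ⟨E', fun p hp => ⟨hE p hp, ?_⟩, fun p hp => ?_⟩ <;> rw [h.1.T_eq hp]
  · exact htime ▸ mem_image_of_mem _ (mem_image_of_mem _ hp)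
  · exact (hkΨ p hp).2.trans (hE' _ (mem_image_of_mem _ hp)).symm

end ExtendedTransformation.IsGivenBy

theorem mem_equivalenceGroup_iff {Ψ : ExtendedTransformation} :
    Ψ ∈ equivalenceGroup ↔ IsConnected Ψ.base.source ∧ ∃ (θ φ : ℝ → ℝ) (δ₁ δ₂ : ℝ),
      IsParameters (Prod.fst '' Ψ.base.source) θ φ δ₁ ∧ Ψ.IsGivenBy θ φ δ₁ δ₂ := by
  refine ⟨fun h => ⟨h.1, exists_isGivenBy_of_mem_equivalenceGroup h⟩, ?_⟩
  rintro ⟨hc, θ, φ, δ₁, δ₂, hpar, h⟩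
  refine ⟨hc, fun E hE => ?_⟩
  obtain ⟨E', htr⟩ := h.exists_transformsElements hpar hc hE
  exact ⟨E', htr, h.mapsEquation hpar htr⟩

theorem exists_mem_equivalenceGroup {Ω : Set Base} {θ φ : ℝ → ℝ} {δ₁ : ℝ} (hΩ : IsOpen Ω)
    (hc : IsConnected Ω) (hpar : IsParameters (Prod.fst '' Ω) θ φ δ₁)
    (hpos : ∀ t ∈ Prod.fst '' Ω, 0 < deriv θ t) (δ₂ : ℝ) :
    ∃ Ψ ∈ equivalenceGroup, Ψ.base.source = Ω ∧ Ψ.IsGivenBy θ φ δ₁ δ₂ := by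
  have hJ := isOpenMap_fst _ hΩ
  have hinj := hpar.injOn_theta hJ (hc.isPreconnected.image _ continuous_fst.continuousOn) hpos
  obtain ⟨Φ, rfl, hf⟩ := exists_pointTransformation hΩ hpar hinj δ₂
  have hθ' : ContDiffOn ℝ ∞ (deriv θ) (Prod.fst '' Φ.source) :=
    hpar.smooth_theta.deriv_of_isOpen hJ le_rfl
  obtain ⟨Ψ, rfl, hΨ, -⟩ := hf.exists_isGivenBy hpar (κ := fun t => δ₁ / √(deriv θ t))
    (contDiffOn_const.div (hθ'.sqrt fun t ht => (hpos t ht).ne')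
      fun t ht => (Real.sqrt_pos.2 (hpos t ht)).ne')
    (fun t ht => by rw [div_pow, Real.sq_sqrt (hpos t ht).le])
  exact ⟨Ψ, mem_equivalenceGroup_iff.2 ⟨hc, θ, φ, δ₁, δ₂, hpar, hΨ⟩, rfl, hΨ⟩

/-! ### Normalization -/

theorem HasForm.exists_transformsElements {E E' : Equation} {Φ : PointTransformation Base}
    {θ φ : ℝ → ℝ} {δ₁ δ₂ : ℝ} (hf : HasForm Φ θ φ δ₁ δ₂)
    (hpar : IsParameters (Prod.fst '' Φ.source) θ φ δ₁) (hfit : Fits Φ E E')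
    (hel : ∀ t ∈ Prod.fst '' Φ.source,
      ElementFormulas θ φ δ₁ t (E.a t, E.b t, E.c t) (E'.a (θ t), E'.b (θ t), E'.c (θ t))) :
    ∃ Ψ : ExtendedTransformation,
      Ψ.base = Φ ∧ Ψ.IsGivenBy θ φ δ₁ δ₂ ∧ Ψ.TransformsElements E E' := by
  have hJE : MapsTo id (Prod.fst '' Φ.source) E.timeDomain := by
    rintro _ ⟨p, hp, rfl⟩
    exact (hfit p hp).1
  have hJE' : MapsTo θ (Prod.fst '' Φ.source) E'.timeDomain := by
    rintro _ ⟨p, hp, rfl⟩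
    exact hf.T_eq hp ▸ (hfit p hp).2
  have ha : ∀ t ∈ Prod.fst '' Φ.source, E.a t ≠ 0 := fun t ht => E.a_ne_zero t (hJE ht)
  -- of the two square roots of `δ₁² / θ_t`, the one that maps the coefficient `a` of `E` to
  -- that of `E'`
  obtain ⟨Ψ, rfl, hΨ, hmap⟩ := hf.exists_isGivenBy hpar (κ := fun t => E'.a (θ t) / E.a t)
    ((E'.smooth_a.comp hpar.smooth_theta hJE').div (E.smooth_a.mono hJE) ha)
    (fun t ht => by
      rw [div_pow, (hel t ht).1, mul_div_cancel_right₀ _ (pow_ne_zero 2 (ha t ht))])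
  refine ⟨Ψ, rfl, hΨ, hfit, fun p hp => ?_⟩
  have ht := mem_image_of_mem Prod.fst hp
  obtain ⟨-, hb, hc⟩ := hel _ ht
  rw [hf.T_eq hp, hmap]
  exact Prod.ext (div_mul_cancel₀ _ (ha _ ht)) (Prod.ext hb.symm hc.symm)

theorem mem_equivalenceGroupoid_iff_exists {E E' : Equation} {Φ : PointTransformation Base} :
    (E, E', Φ) ∈ equivalenceGroupoid ↔
      ∃ Ψ ∈ equivalenceGroup, Ψ.base = Φ ∧ Ψ.TransformsElements E E' := by
  constructor
  · intro hg
    obtain ⟨hc, hfit, θ, φ, δ₁, δ₂, hpar, hf, hel⟩ := mem_equivalenceGroupoid_iff.1 hg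
    obtain ⟨Ψ, rfl, hΨ, htr⟩ := hf.exists_transformsElements hpar hfit hel
    exact ⟨Ψ, mem_equivalenceGroup_iff.2 ⟨hc, θ, φ, δ₁, δ₂, hpar, hΨ⟩, rfl, htr⟩
  · rintro ⟨Ψ, hΨ, rfl, htr⟩
    obtain ⟨hc, θ, φ, δ₁, δ₂, hpar, h⟩ := mem_equivalenceGroup_iff.1 hΨ
    exact ⟨hc, h.mapsEquation hpar htr⟩

end

end NWS

theorem theorem1 :
    -- the transformations that constitute the equivalence group
    (∀ Ψ : NWS.ExtendedTransformation,
      Ψ ∈ NWS.equivalenceGroup ↔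
        IsConnected Ψ.base.source ∧ ∃ (θ φ : ℝ → ℝ) (δ₁ δ₂ : ℝ),
          NWS.IsParameters (Prod.fst '' Ψ.base.source) θ φ δ₁ ∧ Ψ.IsGivenBy θ φ δ₁ δ₂) ∧
    -- all parameters occur (with `θ_t > 0`, as the formula for the squares requires)
    (∀ (Ω : Set NWS.Base), IsOpen Ω → IsConnected Ω → ∀ (θ φ : ℝ → ℝ) (δ₁ δ₂ : ℝ),
      NWS.IsParameters (Prod.fst '' Ω) θ φ δ₁ → (∀ t ∈ Prod.fst '' Ω, 0 < deriv θ t) →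
        ∃ Ψ ∈ NWS.equivalenceGroup, Ψ.base.source = Ω ∧ Ψ.IsGivenBy θ φ δ₁ δ₂) ∧
    -- the equivalence group generates the equivalence groupoid: the class is normalized
    (∀ (E E' : NWS.Equation) (Φ : NWS.PointTransformation NWS.Base),
      (E, E', Φ) ∈ NWS.equivalenceGroupoid ↔
        ∃ Ψ ∈ NWS.equivalenceGroup, Ψ.base = Φ ∧ Ψ.TransformsElements E E') ∧
    -- the explicit form of the equivalence groupoid
    (∀ (E E' : NWS.Equation) (Φ : NWS.PointTransformation NWS.Base),
      (E, E', Φ) ∈ NWS.equivalenceGroupoid ↔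
        IsConnected Φ.source ∧ NWS.Fits Φ E E' ∧ ∃ (θ φ : ℝ → ℝ) (δ₁ δ₂ : ℝ),
          NWS.IsParameters (Prod.fst '' Φ.source) θ φ δ₁ ∧ NWS.HasForm Φ θ φ δ₁ δ₂ ∧
          ∀ t ∈ Prod.fst '' Φ.source,
            NWS.ElementFormulas θ φ δ₁ t (E.a t, E.b t, E.c t)
              (E'.a (θ t), E'.b (θ t), E'.c (θ t))) :=
  ⟨fun _ => NWS.mem_equivalenceGroup_iff,
    fun _ hΩ hc _ _ _ δ₂ hpar hpos => NWS.exists_mem_equivalenceGroup hΩ hc hpar hpos δ₂,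
    fun _ _ _ => NWS.mem_equivalenceGroupoid_iff_exists,
    fun _ _ _ => NWS.mem_equivalenceGroupoid_iff⟩
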